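/- Let $n\ge 1$. Let $\Omega$ be either a connected open subset of $\mathbb{R}^n$ (for instance a smooth bounded domain, or $(0,1)^n$), or the torus $\mathbb{T}^n=\mathbb{R}^n/\mathbb{Z}^n$. The Besov spaces are defined as follows. - Fix Schwartz functions $(\varphi_j)_{j\ge0}$ on $\mathbb{R}^n$ with $\operatorname{supp}\varphi_0\subset B(0,2)$, $\operatorname{supp}\varphi_j\subset B(0,2^{j+1})\setminus B(0,2^{j-1})$ for $j\ge1$, $|D^\alpha\varphi_j|\le c_\alpha 2^{-j|\alpha|}$ for all $j$ and all multi-indices $\alpha$, and $\sum_j\varphi_j=1$. Then $B^s_{p,q}(\mathbb{R}^n)$ is the set of tempered distributions $g$ such that the sequence $\big(2^{sj}\|\mathcal F^{-1}(\varphi_j\mathcal F g)\|_{L^p(\mathbb{R}^n)}\big)_{j\ge0}$ is in $\ell^q$. For $\Omega\subset\mathbb{R}^n$ open, $B^s_{p,q}(\Omega)$ is the set of distributions on $\Omega$ that are restrictions to $\Omega$ of elements of $B^s_{p,q}(\mathbb{R}^n)$. - Fix $\varphi_0\in C^\infty_c(\mathbb{R}^n)$ with $\varphi_0(x)=1$ for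 $|x|<1$ and $\varphi_0(x)=0$ for $|x|\ge 3/2$, and set $\varphi_j(x)=\varphi_0(2^{-j}x)-\varphi_0(2^{-j+1}x)$ for $j\ge1$. Then $B^s_{p,q}(\mathbb{T}^n)$ is the set of distributions on $\mathbb{T}^n$ whose Fourier coefficients $(a_m)_{m\in\mathbb{Z}^n}$ are such that the sequence $\big(2^{sj}\|\sum_{m}a_m\varphi_j(2\pi m)e^{2\pi i m\cdot x}\|_{L^p(\mathbb{T}^n)}\big)_{j\ge0}$ is in $\ell^q$. Functions that are locally integrable on $\Omega$ are identified with the distributions that they define. Then the following hold. 1. Let $s>0$, $1\le p<\infty$ and $1\le q\le\infty$ be such that either $sp\ge1$ and $q<\infty$, or $sp>1$ and $q=\infty$. Then every locally integrable function $f:\Omega\to\mathbb{Z}$ that belongs to $B^s_{p,q}(\Omega)$ is constant almost everywhere. 2. Let $k$ be a natural number and, for $1\le j\le k$, let $s_j>0$, $1\le p_j<\infty$ and $1\le q_j\le\infty$ be such that either $s_jp_j=1$ and $q_j<\infty$, or $s_jp_j>1$. If $f:\Omega\to\mathbb{Z}$ is locally integrable and $f=\sum_{j=1}^k f_j$ as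 distributions, with (possibly complex-valued, not necessarily integer-valued) $f_j\in B^{s_j}_{p_j,q_j}(\Omega)$ for all $j$, then $f$ is constant almost everywhere. -/

import Mathlib

open MeasureTheory TopologicalSpace
open scoped SchwartzMap Distributions ENNReal

noncomputable section

namespace Besov

/-- Euclidean space `ℝⁿ`. -/
abbrev Rn (n : ℕ) : Type := EuclideanSpace ℝ (Fin n)

/-- The dyadic partitions of unity `(φ_j)_{j ≥ 0}` in the Schwartz space used in the
Littlewood-Paley definition of the Besov spaces on `ℝⁿ`. -/
structure IsDyadicPartition {n : ℕ} (φ : ℕ → 𝓢(Rn n, ℂ)) : Prop where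
  tsupport_zero : tsupport (φ 0) ⊆ Metric.ball 0 2
  tsupport_succ : ∀ j : ℕ, tsupport (φ (j + 1)) ⊆
    Metric.ball 0 ((2 : ℝ) ^ (j + 2)) \ Metric.ball 0 ((2 : ℝ) ^ j)
  deriv_bound : ∀ k : ℕ, ∃ c : ℝ, 0 < c ∧ ∀ (j : ℕ) (x : Rn n),
    ‖iteratedFDeriv ℝ k (φ j) x‖ ≤ c * ((2 : ℝ) ^ (j * k))⁻¹
  sum_eq_one : ∀ x : Rn n, HasSum (fun j => φ j x) 1

/-- `g ∈ B^s_{p,q}(ℝⁿ)`: every Littlewood-Paley piece `𝓕⁻¹(φ_j 𝓕 g)` of the tempered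
distribution `g` is an `L^p` function `u j`, and the sequence `2^{sj} ‖u j‖_{L^p}` is in `ℓ^q`. -/
def MemBesov {n : ℕ} (φ : ℕ → 𝓢(Rn n, ℂ)) (s : ℝ) (p q : ℝ≥0∞) [Fact (1 ≤ p)]
    (g : 𝓢'(Rn n, ℂ)) : Prop :=
  ∃ u : ℕ → Lp ℂ p (volume : Measure (Rn n)),
    (∀ j, TemperedDistribution.fourierMultiplierCLM ℂ (φ j) g = (u j : 𝓢'(Rn n, ℂ))) ∧
    Memℓp (fun j : ℕ => (2 : ℝ) ^ (s * j) * ‖u j‖) q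

/-- A test function on `Ω`, extended by zero, as a Schwartz function on `ℝⁿ`. -/
def testToSchwartz {n : ℕ} {Ω : Opens (Rn n)} (ψ : 𝓓(Ω, ℝ)) : 𝓢(Rn n, ℂ) :=
  HasCompactSupport.toSchwartzMap (f := fun x => ((ψ x : ℝ) : ℂ))
    (ψ.hasCompactSupport.comp_left Complex.ofReal_zero)
    (Complex.ofRealCLM.contDiff.comp ψ.contDiff)

/-- `B^s_{p,q}(Ω)`: the distributions on `Ω` that are restrictions to `Ω` of elements of
`B^s_{p,q}(ℝⁿ)`. -/
def besovOn {n : ℕ} (φ : ℕ → 𝓢(Rn n, ℂ)) (s : ℝ) (p q : ℝ≥0∞) [Fact (1 ≤ p)]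
    (Ω : Opens (Rn n)) : Set 𝓓'(Ω, ℂ) :=
  {T | ∃ g : 𝓢'(Rn n, ℂ), MemBesov φ s p q g ∧ ∀ ψ : 𝓓(Ω, ℝ), T ψ = g (testToSchwartz ψ)}

/-- The distribution `ψ ↦ ∫ ψ f` on `Ω` attached to a function `f` that is locally integrable
on `Ω` (the zero distribution if `f` is not locally integrable on `Ω`). -/
def ofFunction {n : ℕ} (Ω : Opens (Rn n)) (f : Rn n → ℂ) : 𝓓'(Ω, ℂ) :=
  (TestFunction.integralAgainstBilinCLM (ContinuousLinearMap.lsmul ℝ ℝ) volume f :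
    𝓓(Ω, ℝ) →L[ℝ] ℂ)

theorem ofFunction_apply {n : ℕ} {Ω : Opens (Rn n)} {f : Rn n → ℂ}
    (hf : LocallyIntegrableOn f Ω) (ψ : 𝓓(Ω, ℝ)) :
    ofFunction Ω f ψ = ∫ x, (ψ x : ℂ) * f x := by
  have h := TestFunction.integralAgainstBilinCLM_eq_integral
    (B := (ContinuousLinearMap.lsmul ℝ ℝ : ℝ →L[ℝ] ℂ →L[ℝ] ℂ)) hf (f := ψ)
  refine Eq.trans h ?_
  simp

/-- The Lebesgue measure of total mass one on the torus `𝕋ⁿ = ℝⁿ / ℤⁿ`. -/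
def torusMeasure (n : ℕ) : Measure (UnitAddTorus (Fin n)) :=
  Measure.pi fun _ => AddCircle.haarAddCircle

/-- The admissible cutoffs `φ₀` in the definition of the Besov spaces on `𝕋ⁿ`. -/
structure IsTorusCutoff {n : ℕ} (φ₀ : Rn n → ℂ) : Prop where
  contDiff : ContDiff ℝ (⊤ : ℕ∞) φ₀
  eq_one : ∀ x, ‖x‖ < 1 → φ₀ x = 1
  eq_zero : ∀ x, 3 / 2 ≤ ‖x‖ → φ₀ x = 0

/-- `φ₀` for `j = 0`, and `φ_j(x) = φ₀(2^{-j} x) - φ₀(2^{-j+1} x)` for `j ≥ 1`. -/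
def torusPartition {n : ℕ} (φ₀ : Rn n → ℂ) : ℕ → Rn n → ℂ
  | 0, x => φ₀ x
  | j + 1, x => φ₀ (((2 : ℝ) ^ (j + 1))⁻¹ • x) - φ₀ (((2 : ℝ) ^ j)⁻¹ • x)

/-- The Littlewood-Paley piece `x ↦ ∑_m a_m φ_j(2πm) e^{2πi m·x}` of the distribution on `𝕋ⁿ`
with Fourier coefficients `a`; only finitely many terms are nonzero. -/
def torusPiece {n : ℕ} (φ₀ : Rn n → ℂ) (a : (Fin n → ℤ) → ℂ) (j : ℕ)
    (x : UnitAddTorus (Fin n)) : ℂ :=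
  ∑ᶠ m : Fin n → ℤ, a m *
    torusPartition φ₀ j (WithLp.toLp 2 fun i => 2 * Real.pi * (m i : ℝ)) *
    UnitAddTorus.mFourier m x

/-- `B^s_{p,q}(𝕋ⁿ)`. A distribution on `𝕋ⁿ` is given by the family `a` of its Fourier
coefficients; the families that occur are exactly those of at most polynomial growth. -/
def besovTorus {n : ℕ} (φ₀ : Rn n → ℂ) (s : ℝ) (p q : ℝ≥0∞) : Set ((Fin n → ℤ) → ℂ) :=
  {a | (∃ (C : ℝ) (N : ℕ), ∀ m, ‖a m‖ ≤ C * (1 + ‖m‖) ^ N) ∧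
    Memℓp (fun j : ℕ => (2 : ℝ) ^ (s * j) *
      (eLpNorm (torusPiece φ₀ a j) p (torusMeasure n)).toReal) q}

end Besov

end

/-! A function in one of the admissible Besov spaces is a convergent sum in `L^p` of
Littlewood-Paley pieces `U j` with `‖U j‖ = o(2^{-j/p})`. In the critical case `sp = 1` this uses `q
< ∞`; for `sp > 1` boundedness of the Besov sequence is enough (`tendsto_div_of_memℓp`). Each piece
is reproduced by a kernel rescaled to the length `2^{-j}`, so Bernstein's inequality controls its
differences, and summing over `j` shows that the second differences with step `2^{-N} h` are
`o(2^{-N/p})` in `L^p` (`tendsto_diff_diff_tsum`).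

Let now an integer-valued `f` be a finite sum of such functions. By Chebyshev, each summand has a
second difference above a fixed threshold only on a set of measure `o(2^{-N})`. With the threshold
below one over the number of summands, the second difference of `f` has modulus less than one off
these sets; being an integer, it is zero.

Walk from `x` to `x + h` in `2^N` steps. The bad starting points form `2^N` translates of a set of
measure `o(2^{-N})`, hence a set of measure `o(1)`. For every other `x`, the values of `f` along the
walk are an arithmetic progression of integers, so `2^N` divides `f (x + h) - f x`. This difference
does not depend on `N`, so it vanishes almost everywhere (`ae_eq_translate_of_tendsto`). Fubini
turns invariance under translations into constancy, on the torus at once and on a domain first on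
small balls, then by connectedness. -/

namespace Besov

open Filter Topology FourierTransform UnitAddTorus

/-! ### Band-limited vectors for an isometric action of `ℝⁿ`, and Bernstein's inequality -/

section Representation

variable {n : ℕ} {E : Type*}
  [NormedAddCommGroup E] [NormedSpace ℂ E]

/-- The difference operator `T_h - 1`. -/
noncomputable def diff (T : Rn n → E →ₗᵢ[ℂ] E) (h : Rn n) : E →L[ℂ] E :=
  (T h).toContinuousLinearMap - ContinuousLinearMap.id ℂ E

@[simp] theorem diff_apply (T : Rn n → E →ₗᵢ[ℂ] E) (h : Rn n) (u : E) : diff T h u = T h u - u := rfl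

theorem norm_diff_apply_le (T : Rn n → E →ₗᵢ[ℂ] E) (h : Rn n) (u : E) : ‖diff T h u‖ ≤ 2 * ‖u‖ := by
  rw [diff_apply]
  refine (norm_sub_le _ _).trans ?_
  rw [LinearIsometry.norm_map]
  linarith

/-- `u` is reproduced by averaging its translates against the kernel `K` rescaled to the
length `r`. -/
def IsBandLimited (K : Rn n → ℂ) (T : Rn n → E →ₗᵢ[ℂ] E) (r : ℝ) (u : E) : Prop :=
  ∫ y, K y • T (-(r • y)) u = u

variable {K : Rn n → ℂ} {T : Rn n → E →ₗᵢ[ℂ] E} {r : ℝ} {u : E}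

theorem integrable_smul_translate (hK : Integrable K) (hcont : ∀ u, Continuous fun y => T y u)
    (r : ℝ) (u : E) (a : Rn n) : Integrable fun y => K y • T (a - r • y) u := by
  refine (hK.norm.mul_const ‖u‖).mono' (hK.aestronglyMeasurable.smul ?_) (.of_forall fun y => ?_)
  · exact ((hcont u).comp (by fun_prop : Continuous fun y : Rn n => a - r • y)).aestronglyMeasurable
  · rw [norm_smul, LinearIsometry.norm_map]

variable [CompleteSpace E]

theorem IsBandLimited.translate (hadd : ∀ a b u, T (a + b) u = T a (T b u))
    (hu : IsBandLimited K T r u) (h : Rn n) : IsBandLimited K T r (T h u) := by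
  unfold IsBandLimited at hu ⊢
  conv_rhs => rw [← hu]
  have := (T h).integral_comp_comm (μ := volume) fun y => K y • T (-(r • y)) u
  rw [← this]
  congr 1 with y
  rw [map_smul, ← hadd, ← hadd, add_comm]

theorem IsBandLimited.diff (hadd : ∀ a b u, T (a + b) u = T a (T b u))
    (hcont : ∀ u, Continuous fun y => T y u) (hK : Integrable K)
    (hu : IsBandLimited K T r u) (h : Rn n) : IsBandLimited K T r (diff T h u) := by
  have h1 := hu.translate hadd h
  unfold IsBandLimited at *
  conv_rhs => rw [diff_apply, ← h1]
  conv_rhs => rw [← hu]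
  rw [← integral_sub]
  · congr 1 with y
    rw [diff_apply, ← smul_sub, map_sub, hu]
  · rw [hu]; simpa using integrable_smul_translate hK hcont r (T h u) 0
  · simpa using integrable_smul_translate hK hcont r u 0

/-- Bernstein's inequality in difference form. -/
theorem IsBandLimited.norm_diff_le (hadd : ∀ a b u, T (a + b) u = T a (T b u))
    (hcont : ∀ u, Continuous fun y => T y u) (hK : Integrable K) {C : ℝ}
    (hKC : ∀ h, ∫ y, ‖K (y + h) - K y‖ ≤ C * ‖h‖) (hr : r ≠ 0)
    (hu : IsBandLimited K T r u) (h : Rn n) : ‖Besov.diff T h u‖ ≤ C * ‖r⁻¹ • h‖ * ‖u‖ := by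
  have h0 : Integrable fun y => K y • T (-(r • y)) u := by
    simpa using integrable_smul_translate hK hcont r u 0
  -- The substitution `y ↦ y + r⁻¹ h` moves the translation from `u` onto the kernel, where
  -- smoothness is available.
  have h1 : T h u = ∫ y, K (y + r⁻¹ • h) • T (-(r • y)) u := by
    rw [← hu.translate hadd h,
      ← integral_add_right_eq_self (μ := volume) (fun y => K y • T (-(r • y)) (T h u)) (r⁻¹ • h)]
    congr 1 with y
    rw [← hadd, smul_add, smul_inv_smul₀ hr]
    congr 3
    abel
  have hKs : Integrable fun y => K (y + r⁻¹ • h) := hK.comp_add_right _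
  have h2 : Integrable fun y => K (y + r⁻¹ • h) • T (-(r • y)) u := by
    simpa using integrable_smul_translate hKs hcont r u 0
  have h3 : Besov.diff T h u = ∫ y, (K (y + r⁻¹ • h) - K y) • T (-(r • y)) u := by
    simp_rw [sub_smul]
    rw [integral_sub h2 h0, ← h1, hu, diff_apply]
  rw [h3]
  calc _ ≤ ∫ y, ‖(K (y + r⁻¹ • h) - K y) • T (-(r • y)) u‖ := norm_integral_le_integral_norm _
    _ = (∫ y, ‖K (y + r⁻¹ • h) - K y‖) * ‖u‖ := by
      rw [← integral_mul_const]
      congr 1 with y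
      rw [norm_smul, LinearIsometry.norm_map]
    _ ≤ _ := by gcongr; exact hKC _

/-- A difference of `u` is again band-limited, so Bernstein applies twice. Order two matters at `p =
1`: there the factor `2^{j-N}` of a single difference is exactly offset by the decay `2^{-j}` of the
pieces, and the sum over `j < N` would not be small. -/
theorem IsBandLimited.norm_diff_diff_le (hadd : ∀ a b u, T (a + b) u = T a (T b u))
    (hcont : ∀ u, Continuous fun y => T y u) (hK : Integrable K) {C : ℝ} (hC : 0 ≤ C)
    (hKC : ∀ h, ∫ y, ‖K (y + h) - K y‖ ≤ C * ‖h‖) (hr : r ≠ 0)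
    (hu : IsBandLimited K T r u) (h : Rn n) :
    ‖Besov.diff T h (Besov.diff T h u)‖ ≤ (C * ‖r⁻¹ • h‖) ^ 2 * ‖u‖ := by
  refine ((hu.diff hadd hcont hK h).norm_diff_le hadd hcont hK hKC hr h).trans ?_
  rw [sq, mul_assoc (C * ‖r⁻¹ • h‖)]
  refine mul_le_mul_of_nonneg_left ?_ (by positivity)
  exact hu.norm_diff_le hadd hcont hK hKC hr h

end Representation

/-! ### Limits of the low- and high-frequency sums -/

section Scalar

/-- A dyadic Tannery argument. -/
theorem tendsto_sum_low {x A : ℝ} (hx : 1 / 2 ≤ x) {a : ℕ → ℝ} (ha : ∀ j, |a j| ≤ A)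
    (ha0 : Tendsto a atTop (𝓝 0)) :
    Tendsto (fun N : ℕ => ∑ j ∈ Finset.range N, (4 : ℝ) ^ j * x ^ j * a j / (4 ^ N * x ^ N))
      atTop (𝓝 0) := by
  have hx0 : 0 < x := by linarith
  have hA : 0 ≤ A := (abs_nonneg _).trans (ha 0)
  -- Reindexing by `i = N - 1 - j` makes the weight `(4x)^{j-N}` independent of `N`. Since `4x ≥ 2`,
  -- it is dominated by `2^{-i}`.
  let F : ℕ → ℕ → ℝ := fun N i => if i < N then ((4 * x)⁻¹) ^ (i + 1) * a (N - 1 - i) else 0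
  have hq : (4 * x)⁻¹ ≤ 1 / 2 := by
    rw [inv_le_comm₀ (by positivity) (by positivity)]; linarith
  have key : Tendsto (fun N => ∑' i, F N i) atTop (𝓝 (∑' _ : ℕ, (0 : ℝ))) := by
    refine tendsto_tsum_of_dominated_convergence (bound := fun i => (1 / 2 : ℝ) ^ i * A)
      (summable_geometric_two.mul_right A) (fun i => ?_) (.of_forall fun N i => ?_)
    · have h1 : Tendsto (fun N : ℕ => ((4 * x)⁻¹) ^ (i + 1) * a (N - 1 - i)) atTop (𝓝 0) := by
        rw [← mul_zero (((4 * x)⁻¹) ^ (i + 1))]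
        refine Tendsto.const_mul _ (ha0.comp ?_)
        exact (tendsto_sub_atTop_nat i).comp (tendsto_sub_atTop_nat 1)
      refine h1.congr' ?_
      filter_upwards [eventually_gt_atTop i] with N hN
      simp [F, hN]
    · simp only [F]
      split_ifs
      · rw [Real.norm_eq_abs, abs_mul, abs_of_nonneg (by positivity)]
        refine mul_le_mul ?_ (ha _) (abs_nonneg _) (by positivity)
        calc ((4 * x)⁻¹) ^ (i + 1) ≤ (1 / 2) ^ (i + 1) := by gcongr
          _ ≤ (1 / 2) ^ i := pow_le_pow_of_le_one (by norm_num) (by norm_num) (by omega)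
      · simp only [norm_zero]; positivity
  rw [tsum_zero] at key
  refine key.congr fun N => ?_
  rw [tsum_eq_sum (s := Finset.range N) (fun i hi => by simp_all [F]),
    ← Finset.sum_range_reflect]
  refine Finset.sum_congr rfl fun j hj => ?_
  have hj : j < N := Finset.mem_range.mp hj
  have e : N = (N - 1 - j) + (j + 1) := by omega
  have h2 : (4 : ℝ) ^ N * x ^ N = (4 * x) ^ (N - 1 - j) * (4 * x) ^ (j + 1) := by
    rw [← mul_pow, ← pow_add, ← e]
  have h3 : N - 1 - (N - 1 - j) = j := by omega
  simp only [F]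
  rw [if_pos (by omega), h3, inv_pow]
  have h4 : (4 : ℝ) ^ N * x ^ N = (4 * x) ^ j * (4 * x) ^ (N - 1 - j + 1) := by
    rw [← mul_pow, ← pow_add]; congr 1; omega
  rw [h4, ← mul_pow]
  field_simp

theorem tendsto_tsum_high {x A : ℝ} (hx0 : 0 ≤ x) (hx : x < 1) {a : ℕ → ℝ} (ha : ∀ j, |a j| ≤ A)
    (ha0 : Tendsto a atTop (𝓝 0)) :
    Tendsto (fun N : ℕ => ∑' i, x ^ i * a (i + N)) atTop (𝓝 0) := by
  have hA : 0 ≤ A := (abs_nonneg _).trans (ha 0)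
  have key : Tendsto (fun N : ℕ => ∑' i, x ^ i * a (i + N)) atTop (𝓝 (∑' _ : ℕ, (0 : ℝ))) := by
    refine tendsto_tsum_of_dominated_convergence (bound := fun i => x ^ i * A)
      ((summable_geometric_of_lt_one hx0 hx).mul_right A) (fun i => ?_) (.of_forall fun N i => ?_)
    · rw [← mul_zero (x ^ i)]
      refine Tendsto.const_mul _ (ha0.comp ?_)
      simpa [add_comm] using tendsto_add_atTop_nat i
    · rw [Real.norm_eq_abs, abs_mul, abs_of_nonneg (by positivity)]
      gcongr
      exact ha _
  simpa using key

end Scalar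

/-! ### Second differences of a Littlewood-Paley series -/

section Series

variable {n : ℕ} {E : Type*}
  [NormedAddCommGroup E] [NormedSpace ℂ E] [CompleteSpace E]

theorem summable_of_tendsto_div {E : Type*} [NormedAddCommGroup E] [CompleteSpace E] {x : ℝ} (hx0 : 0 < x) (hx : x < 1) {U : ℕ → E}
    (hU : Tendsto (fun j => ‖U j‖ / x ^ j) atTop (𝓝 0)) : Summable U := by
  obtain ⟨A, hA⟩ := hU.bddAbove_range
  refine Summable.of_norm_bounded (g := fun j => x ^ j * A)
    ((summable_geometric_of_lt_one hx0.le hx).mul_right A) fun j => ?_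
  have := hA ⟨j, rfl⟩
  rwa [div_le_iff₀' (by positivity)] at this

/-- If the Littlewood-Paley pieces of `∑ U_j` are `o(x^j)`, then so are the second differences
with dyadic steps. -/
theorem tendsto_diff_diff_tsum {K : Rn n → ℂ} {T : Rn n → E →ₗᵢ[ℂ] E}
    (hadd : ∀ a b u, T (a + b) u = T a (T b u))
    (hcont : ∀ u, Continuous fun y => T y u) (hK : Integrable K) {C : ℝ} (hC : 0 ≤ C)
    (hKC : ∀ h, ∫ y, ‖K (y + h) - K y‖ ≤ C * ‖h‖) {x : ℝ} (hx0 : 1 / 2 ≤ x) (hx : x < 1)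
    {U : ℕ → E} (hband : ∀ j, IsBandLimited K T ((1 / 2 : ℝ) ^ j) (U j))
    (hU : Tendsto (fun j => ‖U j‖ / x ^ j) atTop (𝓝 0)) (h : Rn n) :
    Tendsto (fun N : ℕ => ‖diff T ((1 / 2 : ℝ) ^ N • h) (diff T ((1 / 2 : ℝ) ^ N • h) (∑' j, U j))‖
      / x ^ N) atTop (𝓝 0) := by
  have hx1 : 0 < x := by linarith
  have hs := summable_of_tendsto_div hx1 hx hU
  obtain ⟨A, hA⟩ := hU.bddAbove_range
  have hA' : ∀ j, |‖U j‖ / x ^ j| ≤ A := fun j => by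
    rw [abs_of_nonneg (by positivity)]; exact hA ⟨j, rfl⟩
  -- Pieces with `j < N` are bounded by Bernstein applied twice, hence `(C‖h‖)²`; for `j ≥ N` the
  -- two differences cost only the trivial factor `2 * 2`.
  have lim := ((tendsto_sum_low hx0 hA' hU).const_mul ((C * ‖h‖) ^ 2)).add
    ((tendsto_tsum_high hx1.le hx hA' hU).const_mul 4)
  simp only [mul_zero, add_zero] at lim
  refine squeeze_zero (fun N => by positivity) (fun N => ?_) lim
  set k := (1 / 2 : ℝ) ^ N • h with hk
  rw [div_le_iff₀ (by positivity)]
  have hs2 : Summable fun i => U (i + N) := (summable_nat_add_iff N).mpr hs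
  have hs3 : Summable fun i => ‖U (i + N)‖ := by
    refine Summable.of_nonneg_of_le (fun _ => norm_nonneg _) (fun j => ?_)
      (((summable_geometric_of_lt_one hx1.le hx).comp_injective (add_left_injective N)).mul_right A)
    have := hA ⟨j + N, rfl⟩
    rwa [div_le_iff₀' (by positivity)] at this
  rw [← hs.sum_add_tsum_nat_add N]
  simp only [map_add, map_sum]
  refine (norm_add_le _ _).trans ?_
  rw [add_mul]
  refine add_le_add ((norm_sum_le _ _).trans ?_) ?_
  · rw [Finset.mul_sum, Finset.sum_mul]
    refine Finset.sum_le_sum fun j _ => ?_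
    refine ((hband j).norm_diff_diff_le hadd hcont hK hC hKC (by positivity) k).trans_eq ?_
    rw [hk, norm_smul, norm_smul, norm_inv, norm_pow, norm_pow]
    have e : ∀ i : ℕ, (4 : ℝ) ^ i = (((1 / 2 : ℝ) ^ i)⁻¹) ^ 2 := fun i => by
      rw [← inv_pow, ← pow_mul, mul_comm, pow_mul]; norm_num
    rw [e j, e N, Real.norm_of_nonneg (by norm_num : (0 : ℝ) ≤ 1 / 2)]
    generalize (1 / 2 : ℝ) ^ N = b
    field_simp
  · calc _ ≤ 2 * (2 * ‖∑' i, U (i + N)‖) :=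
        (norm_diff_apply_le _ _ _).trans (by gcongr; exact norm_diff_apply_le _ _ _)
      _ ≤ 2 * (2 * ∑' i, ‖U (i + N)‖) := by gcongr; exact norm_tsum_le_tsum_norm hs3
      _ = _ := by
        rw [mul_assoc 4, ← tsum_mul_right, ← mul_assoc]
        norm_num
        congr 1 with i
        rw [pow_add]
        field_simp

end Series

/-! ### The reproducing kernel -/

section Kernel

variable {n : ℕ}

/-- For `‖h‖ ≤ 1` this is the mean value inequality with the decay of the derivative, of order `n +
1` so as to be integrable. For `‖h‖ ≥ 1` the triangle inequality suffices. -/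
theorem exists_integral_norm_translate_sub_le (f : 𝓢(Rn n, ℂ)) :
    ∃ C : ℝ, 0 ≤ C ∧ ∀ h, ∫ y, ‖f (y + h) - f y‖ ≤ C * ‖h‖ := by
  set d := n + 1
  set S := 2 ^ d * (Finset.Iic (d, 1)).sup (fun m => SchwartzMap.seminorm ℝ m.1 m.2) f with hS
  have hS0 : 0 ≤ S := by positivity
  have hdecay : ∀ x, ‖fderiv ℝ f x‖ ≤ S * ((1 + ‖x‖) ^ d)⁻¹ := fun x => by
    have := SchwartzMap.one_add_le_sup_seminorm_apply (𝕜 := ℝ) (m := (d, 1)) le_rfl le_rfl f x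
    rw [norm_iteratedFDeriv_one] at this
    rw [← div_eq_mul_inv, le_div_iff₀' (by positivity)]
    exact this
  have hint : Integrable fun y : Rn n => ((1 + ‖y‖) ^ d)⁻¹ := by
    have := integrable_one_add_norm (E := Rn n) (μ := volume) (r := d) (by simp [d])
    refine this.congr (.of_forall fun y => ?_)
    dsimp only
    rw [Real.rpow_neg (by positivity), Real.rpow_natCast]
  have hf : Integrable f := f.integrable
  set C1 := ∫ y : Rn n, S * 2 ^ d * ((1 + ‖y‖) ^ d)⁻¹
  set C2 := 2 * ∫ y, ‖f y‖
  have hC1 : 0 ≤ C1 := integral_nonneg fun y => by positivity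
  have hC2 : 0 ≤ C2 := mul_nonneg zero_le_two (integral_nonneg fun y => norm_nonneg _)
  refine ⟨C1 + C2, by positivity, fun h => ?_⟩
  rcases le_total ‖h‖ 1 with h1 | h1
  · have hb : ∀ y, ‖f (y + h) - f y‖ ≤ S * 2 ^ d * ((1 + ‖y‖) ^ d)⁻¹ * ‖h‖ := fun y => by
      -- The factor `2 ^ d` comes from `1 + ‖y‖ ≤ 2 (1 + ‖z‖)` when `‖z - y‖ ≤ 1`.
      have hball : ∀ z ∈ Metric.closedBall y 1,
          ‖fderiv ℝ f z‖ ≤ S * 2 ^ d * ((1 + ‖y‖) ^ d)⁻¹ := fun z hz => by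
        refine (hdecay z).trans ?_
        rw [mul_assoc S]
        refine mul_le_mul_of_nonneg_left ?_ hS0
        rw [← div_eq_mul_inv, inv_eq_one_div, div_le_div_iff₀ (by positivity) (by positivity),
          one_mul, ← mul_pow]
        gcongr
        have h2 : ‖y‖ ≤ ‖z‖ + ‖z - y‖ := by
          simpa using norm_sub_le z (z - y)
        have h3 : ‖z - y‖ ≤ 1 := by simpa [dist_eq_norm] using hz
        linarith [norm_nonneg z]
      have := (convex_closedBall y 1).norm_image_sub_le_of_norm_fderiv_le (𝕜 := ℝ) (f := f)
        (fun z _ => f.differentiableAt) hball (Metric.mem_closedBall_self zero_le_one)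
        (y := y + h) (by simpa using h1)
      simpa using this
    calc ∫ y, ‖f (y + h) - f y‖ ≤ ∫ y, S * 2 ^ d * ((1 + ‖y‖) ^ d)⁻¹ * ‖h‖ :=
          integral_mono ((hf.comp_add_right h).sub hf).norm ((hint.const_mul _).mul_const _) hb
      _ = C1 * ‖h‖ := integral_mul_const _ _
      _ ≤ _ := by gcongr; linarith
  · calc ∫ y, ‖f (y + h) - f y‖ ≤ ∫ y, (‖f (y + h)‖ + ‖f y‖) :=
          integral_mono ((hf.comp_add_right h).sub hf).norm
            ((hf.comp_add_right h).norm.add hf.norm) fun y => norm_sub_le _ _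
      _ = C2 := by
        rw [integral_add (hf.comp_add_right h).norm hf.norm,
          integral_add_right_eq_self (fun y => ‖f y‖) h]
        ring
      _ ≤ C2 * ‖h‖ := le_mul_of_one_le_right hC2 h1
      _ ≤ _ := by gcongr; linarith

theorem exists_schwartz_eq_one (n : ℕ) :
    ∃ χ : 𝓢(Rn n, ℂ), ∀ ξ, ‖ξ‖ ≤ 2 → χ ξ = 1 := by
  let b : ContDiffBump (0 : Rn n) := ⟨2, 3, by norm_num, by norm_num⟩
  have hb : ContDiff ℝ (⊤ : ℕ∞) (fun x => ((b x : ℝ) : ℂ)) := Complex.ofRealCLM.contDiff.comp b.contDiff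
  have hc : HasCompactSupport (fun x => ((b x : ℝ) : ℂ)) :=
    b.hasCompactSupport.comp_left Complex.ofReal_zero
  refine ⟨hc.toSchwartzMap hb, fun ξ hξ => ?_⟩
  change ((b ξ : ℝ) : ℂ) = 1
  rw [b.one_of_mem_closedBall (by simpa using hξ), Complex.ofReal_one]

end Kernel

/-! ### Translations on `L^p` and Chebyshev's inequality -/

section Translation

variable {n : ℕ} {X : Type*} [AddCommGroup X] [TopologicalSpace X] [IsTopologicalAddGroup X]
  [MeasurableSpace X] [BorelSpace X] {μ : Measure X} [μ.IsAddLeftInvariant]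
  {p : ℝ≥0∞} [Fact (1 ≤ p)]

/-- Translation by `π y` on `L^p(X)`. -/
noncomputable def translate (μ : Measure X) [μ.IsAddLeftInvariant] (p : ℝ≥0∞) [Fact (1 ≤ p)] (π : Rn n →ₜ+ X)
    (y : Rn n) : Lp ℂ p μ →ₗᵢ[ℂ] Lp ℂ p μ :=
  Lp.compMeasurePreservingₗᵢ ℂ (fun x => x + π y) (measurePreserving_add_right μ (π y))

theorem coeFn_translate (π : Rn n →ₜ+ X) (y : Rn n) (u : Lp ℂ p μ) :
    translate μ p π y u =ᵐ[μ] fun x => u (x + π y) :=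
  Lp.coeFn_compMeasurePreserving u (measurePreserving_add_right μ (π y))

theorem translate_add (π : Rn n →ₜ+ X) (a b : Rn n) (u : Lp ℂ p μ) :
    translate μ p π (a + b) u = translate μ p π a (translate μ p π b u) := by
  apply Lp.ext
  refine (coeFn_translate π (a + b) u).trans (EventuallyEq.trans ?_ (coeFn_translate π a _).symm)
  have := (measurePreserving_add_right μ (π a)).quasiMeasurePreserving.ae_eq
    (coeFn_translate π b u)
  refine EventuallyEq.trans (.of_forall fun x => ?_) this.symm
  simp [map_add, add_assoc]

theorem continuous_translate [IsLocallyFiniteMeasure μ] [μ.InnerRegularCompactLTTop]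
    (hp : p ≠ ∞) (π : Rn n →ₜ+ X) (u : Lp ℂ p μ) : Continuous fun y => translate μ p π y u := by
  let g : C(Rn n, C(X, X)) :=
    (ContinuousMap.mk (fun a : Rn n × X => a.2 + π a.1) (by fun_prop)).curry
  exact continuous_const.compMeasurePreservingLp g.continuous
    (fun y => measurePreserving_add_right μ (π y)) hp

theorem coeFn_diff_diff (π : Rn n →ₜ+ X) (h : Rn n) (u : Lp ℂ p μ) :
    diff (translate μ p π) h (diff (translate μ p π) h u) =ᵐ[μ]
      fun x => u (x + π h + π h) - 2 * u (x + π h) + u x := by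
  have h1 := coeFn_translate π h u
  have h2 := (coeFn_translate π h (translate μ p π h u)).trans
    ((measurePreserving_add_right μ (π h)).quasiMeasurePreserving.ae_eq h1)
  simp only [diff_apply, map_sub]
  have h3 := Lp.coeFn_sub (translate μ p π h (translate μ p π h u) - translate μ p π h u)
    (translate μ p π h u - u)
  have h4 := Lp.coeFn_sub (translate μ p π h (translate μ p π h u)) (translate μ p π h u)
  have h5 := Lp.coeFn_sub (translate μ p π h u) u
  filter_upwards [h1, h2, h3, h4, h5] with x h1 h2 h3 h4 h5
  rw [h3, Pi.sub_apply, h4, h5, Pi.sub_apply, Pi.sub_apply, h2, Function.comp_apply, h1]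
  ring

/-- Chebyshev's inequality turns decay of second differences in `L^p` into decay of the measure
of the set where they are large. -/
theorem tendsto_measure_diff_diff (hp : p ≠ ∞) (π : Rn n →ₜ+ X) (h : Rn n) (G : Lp ℂ p μ)
    (hG : Tendsto (fun N : ℕ => ‖diff (translate μ p π) ((1 / 2 : ℝ) ^ N • h)
      (diff (translate μ p π) ((1 / 2 : ℝ) ^ N • h) G)‖ / ((1 / 2 : ℝ) ^ (p.toReal⁻¹)) ^ N)
      atTop (𝓝 0)) {c : ℝ} (hc : 0 < c) :
    Tendsto (fun N : ℕ => 2 ^ N * μ {x | c ≤ ‖G (x + π ((1 / 2 : ℝ) ^ N • h) +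
      π ((1 / 2 : ℝ) ^ N • h)) - 2 * G (x + π ((1 / 2 : ℝ) ^ N • h)) + G x‖}) atTop (𝓝 0) := by
  have hp1 : 1 ≤ p := Fact.out
  have hp0 : p ≠ 0 := (zero_lt_one.trans_le hp1).ne'
  have hpr : 0 < p.toReal := ENNReal.toReal_pos hp0 hp
  set D : ℕ → Lp ℂ p μ := fun N => diff (translate μ p π) ((1 / 2 : ℝ) ^ N • h)
      (diff (translate μ p π) ((1 / 2 : ℝ) ^ N • h) G) with hD
  have key : ∀ N, 2 ^ N * μ {x | c ≤ ‖G (x + π ((1 / 2 : ℝ) ^ N • h) +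
      π ((1 / 2 : ℝ) ^ N • h)) - 2 * G (x + π ((1 / 2 : ℝ) ^ N • h)) + G x‖} ≤
      ENNReal.ofReal (c⁻¹ ^ p.toReal *
        (‖D N‖ / ((1 / 2 : ℝ) ^ (p.toReal⁻¹)) ^ N) ^ p.toReal) := fun N => by
    have h1 := meas_ge_le_mul_pow_eLpNorm_enorm μ hp0 hp (Lp.aestronglyMeasurable (D N))
      (ε := ENNReal.ofReal c) (by simpa using hc) (by simp)
    have h2 : μ {x | c ≤ ‖G (x + π ((1 / 2 : ℝ) ^ N • h) +
      π ((1 / 2 : ℝ) ^ N • h)) - 2 * G (x + π ((1 / 2 : ℝ) ^ N • h)) + G x‖} =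
        μ {x | ENNReal.ofReal c ≤ ‖D N x‖ₑ} := by
      apply measure_congr
      filter_upwards [coeFn_diff_diff π ((1 / 2 : ℝ) ^ N • h) G] with x hx
      apply propext
      change c ≤ _ ↔ ENNReal.ofReal c ≤ ‖D N x‖ₑ
      rw [hD, hx, ← ofReal_norm, ENNReal.ofReal_le_ofReal_iff (norm_nonneg _)]
    rw [h2]
    refine (mul_le_mul_right h1 _).trans_eq ?_
    have h3 : eLpNorm (D N) p μ = ENNReal.ofReal ‖D N‖ := by
      rw [Lp.norm_def, ENNReal.ofReal_toReal (Lp.eLpNorm_ne_top _)]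
    have h4 : (2 : ℝ≥0∞) ^ N = ENNReal.ofReal (2 ^ N) := by
      rw [ENNReal.ofReal_pow (by norm_num)]; simp
    rw [h3, h4, ← ENNReal.ofReal_inv_of_pos hc,
      ENNReal.ofReal_rpow_of_nonneg (by positivity) hpr.le,
      ENNReal.ofReal_rpow_of_nonneg (by positivity) hpr.le, ← ENNReal.ofReal_mul (by positivity),
      ← ENNReal.ofReal_mul (by positivity)]
    congr 1
    -- The `p`-th power of the rate `2^{-N/p}` cancels the factor `2 ^ N` exactly.
    have h5 : (((1 / 2 : ℝ) ^ p.toReal⁻¹) ^ N) ^ p.toReal = (2 ^ N)⁻¹ := by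
      rw [← Real.rpow_natCast, ← Real.rpow_mul (by positivity), ← Real.rpow_mul (by positivity),
        show p.toReal⁻¹ * (N * p.toReal) = N by field_simp, Real.rpow_natCast, one_div, inv_pow]
    rw [Real.div_rpow (by positivity) (by positivity), h5]
    field_simp
  refine tendsto_of_tendsto_of_tendsto_of_le_of_le tendsto_const_nhds ?_ (fun _ => zero_le) key
  have := ((hG.rpow_const (p := p.toReal) (Or.inr hpr.le)).const_mul (c⁻¹ ^ p.toReal))
  rw [Real.zero_rpow hpr.ne', mul_zero] at this
  rw [← ENNReal.ofReal_zero]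
  exact ENNReal.tendsto_ofReal this

end Translation

/-! ### From small second differences to translation invariance -/

/-- The sequence is an arithmetic progression up to `M`, so the total increment is `M` times the
common difference, which is an integer. -/
theorem dvd_sub_of_second_diff_eq_zero {a : ℕ → ℤ} {M : ℕ}
    (ha : ∀ i, i + 2 ≤ M → a (i + 2) - 2 * a (i + 1) + a i = 0) : (M : ℤ) ∣ a M - a 0 := by
  have key : ∀ i, i + 1 ≤ M → a (i + 1) - a i = a 1 - a 0 := fun i => by
    induction i with
    | zero => intro _; rfl
    | succ i ih => intro hi; have h1 := ha i hi; have h2 := ih (by omega); linarith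
  have key2 : ∀ i, i ≤ M → a i - a 0 = i * (a 1 - a 0) := fun i => by
    induction i with
    | zero => intro _; simp
    | succ i ih =>
      intro hi
      have h1 := key i hi
      have h2 := ih (by omega)
      push_cast
      linarith
  exact ⟨_, key2 M le_rfl⟩

section

variable {n : ℕ} {X : Type*} [AddCommGroup X] [TopologicalSpace X] [IsTopologicalAddGroup X]
  [MeasurableSpace X] [BorelSpace X] {μ : Measure X} [μ.IsAddLeftInvariant]

/-- An integer-valued function whose second differences with step `2^{-N} h` vanish off a set of
measure `o(2^{-N})` is invariant under translation by `h`. -/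
theorem ae_eq_translate_of_tendsto {f : X → ℤ} (hf : Measurable f) {π : Rn n →ₜ+ X} {h : Rn n}
    {W₀ W₁ : Set X} (hW₀ : MeasurableSet W₀) (hμW₀ : μ W₀ ≠ ∞)
    (hW : ∀ x ∈ W₀, ∀ t ∈ Set.Icc (0 : ℝ) 1, x + π (t • h) ∈ W₁)
    (hB : Tendsto (fun N : ℕ => 2 ^ N * μ {y | y ∈ W₁ ∧
      f (y + π ((1 / 2 : ℝ) ^ N • h) + π ((1 / 2 : ℝ) ^ N • h)) -
        2 * f (y + π ((1 / 2 : ℝ) ^ N • h)) + f y ≠ 0}) atTop (𝓝 0)) :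
    ∀ᵐ x ∂μ, x ∈ W₀ → f (x + π h) = f x := by
  set B : ℕ → Set X := fun N => {y | y ∈ W₁ ∧
      f (y + π ((1 / 2 : ℝ) ^ N • h) + π ((1 / 2 : ℝ) ^ N • h)) -
        2 * f (y + π ((1 / 2 : ℝ) ^ N • h)) + f y ≠ 0} with hBdef
  have hg : Measurable fun x => f (x + π h) - f x :=
    (hf.comp (measurable_add_const (π h))).sub hf
  -- Points where a nonzero multiple of `2 ^ N` is possible. These sets decrease to `∅` and `W₀` has
  -- finite measure, so their measures tend to zero.
  let L : ℕ → Set X := fun N => W₀ ∩ {x | (2 : ℤ) ^ N ≤ |f (x + π h) - f x|}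
  have hL : Tendsto (fun N => μ (L N)) atTop (𝓝 0) := by
    have hmeas : ∀ N, MeasurableSet (L N) := fun N =>
      hW₀.inter (hg (MeasurableSet.of_discrete (s := {z : ℤ | (2 : ℤ) ^ N ≤ |z|})))
    have hanti : Antitone L := fun N M hNM x hx =>
      ⟨hx.1, (pow_le_pow_right₀ (by norm_num : (1 : ℤ) ≤ 2) hNM).trans hx.2⟩
    have := tendsto_measure_iInter_atTop (μ := μ) (fun N => (hmeas N).nullMeasurableSet) hanti
      ⟨0, measure_ne_top_of_subset Set.inter_subset_left hμW₀⟩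
    have hemp : ⋂ N, L N = ∅ := by
      refine Set.eq_empty_of_forall_notMem fun x hx => ?_
      have h1 := (Set.mem_iInter.mp hx (f (x + π h) - f x).natAbs).2
      have h2 : ((f (x + π h) - f x).natAbs : ℤ) < 2 ^ (f (x + π h) - f x).natAbs := by
        exact_mod_cast Nat.lt_two_pow_self
      rw [Int.natCast_natAbs] at h2
      exact absurd h1 (not_le.mpr h2)
    rwa [hemp, measure_empty] at this
  have hcover : ∀ N, {x | ¬(x ∈ W₀ → f (x + π h) = f x)} ⊆
      L N ∪ ⋃ i ∈ Finset.range (2 ^ N), (fun x => x + i • π ((1 / 2 : ℝ) ^ N • h)) ⁻¹' B N := by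
    intro N x hx
    rw [Set.mem_ofPred_eq, Classical.not_imp] at hx
    obtain ⟨hxW, hne⟩ := hx
    by_contra hcon
    rw [Set.mem_union, not_or] at hcon
    obtain ⟨hnL, hnB⟩ := hcon
    set e := π ((1 / 2 : ℝ) ^ N • h) with he
    have hmul : ∀ i : ℕ, i • e = π ((i * (1 / 2 : ℝ) ^ N) • h) := fun i => by
      rw [he, ← map_nsmul, mul_smul, Nat.cast_smul_eq_nsmul]
    have hend : (2 ^ N : ℕ) • e = π h := by
      rw [hmul]; simp
    have hdvd := dvd_sub_of_second_diff_eq_zero (a := fun i => f (x + i • e)) (M := 2 ^ N)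
      fun i hi => by
        by_contra hc
        refine hnB (Set.mem_biUnion (x := i)
          (Finset.mem_coe.mpr (Finset.mem_range.mpr (by omega))) ⟨?_, ?_⟩)
        · show x + i • e ∈ W₁
          rw [hmul]
          refine hW x hxW _ ⟨by positivity, ?_⟩
          rw [one_div, inv_pow, ← div_eq_mul_inv, div_le_one (by positivity)]
          exact_mod_cast (by omega : i ≤ 2 ^ N)
        · show f (x + i • e + e + e) - 2 * f (x + i • e + e) + f (x + i • e) ≠ 0
          have e1 : x + i • e + e = x + (i + 1) • e := by rw [add_assoc, succ_nsmul]
          have e2 : x + (i + 1) • e + e = x + (i + 2) • e := by rw [add_assoc, ← succ_nsmul]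
          rwa [e1, e2]
    simp only [hend, zero_smul, add_zero] at hdvd
    refine hnL ⟨hxW, ?_⟩
    have := Int.le_of_dvd (abs_pos.mpr (sub_ne_zero.mpr hne)) ((dvd_abs _ _).mpr hdvd)
    simpa using this
  have hbound : ∀ N, μ {x | ¬(x ∈ W₀ → f (x + π h) = f x)} ≤ μ (L N) + 2 ^ N * μ (B N) := by
    intro N
    refine (measure_mono (hcover N)).trans ((measure_union_le _ _).trans ?_)
    gcongr
    refine (measure_biUnion_finset_le _ _).trans ?_
    -- By invariance all `2 ^ N` translates of `B N` have the same measure.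
    simp_rw [measure_preimage_add_right]
    simp
  have hlim := hL.add hB
  rw [add_zero] at hlim
  exact le_antisymm (ge_of_tendsto' hlim hbound) zero_le

/-- An integer-valued function that is a finite sum of `L^p` functions whose second differences
with step `2^{-N} h` are `o(2^{-N/p})` is invariant under translation by `h`. -/
theorem ae_eq_translate_of_sum {f : X → ℤ} (hf : Measurable f) {π : Rn n →ₜ+ X} {h : Rn n}
    {Ω W : Set X} (hW : MeasurableSet W) (hμW : μ W ≠ ∞)
    (hWΩ : ∀ x ∈ W, ∀ t ∈ Set.Icc (0 : ℝ) 3, x + π (t • h) ∈ Ω)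
    {k : ℕ} {p : Fin k → ℝ≥0∞} [∀ i, Fact (1 ≤ p i)] (hp : ∀ i, p i ≠ ∞)
    (G : ∀ i, Lp ℂ (p i) μ) (hfG : ∀ᵐ x ∂μ, x ∈ Ω → (f x : ℂ) = ∑ i, G i x)
    (hG : ∀ i, Tendsto (fun N : ℕ => ‖diff (translate μ (p i) π) ((1 / 2 : ℝ) ^ N • h)
      (diff (translate μ (p i) π) ((1 / 2 : ℝ) ^ N • h) (G i))‖ /
        ((1 / 2 : ℝ) ^ ((p i).toReal⁻¹)) ^ N) atTop (𝓝 0)) :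
    ∀ᵐ x ∂μ, x ∈ W → f (x + π h) = f x := by
  -- Room for the walk: a starting point is displaced by at most `h`, and the two further steps of a
  -- second difference by at most `2h`, which makes the `3` of `hWΩ`.
  refine ae_eq_translate_of_tendsto hf hW hμW
    (W₁ := {y | ∀ t ∈ Set.Icc (0 : ℝ) 2, y + π (t • h) ∈ Ω}) ?_ ?_
  · intro x hx s hs t ht
    rw [add_assoc, ← map_add, ← add_smul]
    exact hWΩ x hx _ ⟨add_nonneg hs.1 ht.1, by linarith [hs.2, ht.2]⟩
  -- With this threshold `k` small second differences add up to at most `k / (k + 1) < 1`; the case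
  -- `k = 0` is included.
  have hc : (0 : ℝ) < ((k : ℝ) + 1)⁻¹ := by positivity
  have hlim := tendsto_finsetSum Finset.univ
    fun i _ => tendsto_measure_diff_diff (hp i) π h (G i) (hG i) hc
  rw [Finset.sum_const_zero] at hlim
  refine tendsto_of_tendsto_of_tendsto_of_le_of_le tendsto_const_nhds hlim
    (fun _ => zero_le) fun N => ?_
  simp only
  rw [← Finset.mul_sum]
  gcongr
  set e := π ((1 / 2 : ℝ) ^ N • h) with he
  have h0 := hfG
  have h1 := (measurePreserving_add_right μ e).quasiMeasurePreserving.ae h0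
  have h2 := (measurePreserving_add_right μ e).quasiMeasurePreserving.ae h1
  refine le_trans (measure_mono_ae ?_) (measure_biUnion_finset_le Finset.univ _)
  filter_upwards [h0, h1, h2] with y h0 h1 h2 hy
  obtain ⟨hyW, hne⟩ := hy
  have hpow : (1 / 2 : ℝ) ^ N ≤ 1 := pow_le_one₀ (by norm_num) (by norm_num)
  have m0 : y ∈ Ω := by simpa using hyW 0 (by norm_num)
  have m1 : y + e ∈ Ω := hyW _ ⟨by positivity, by linarith⟩
  have m2 : y + e + e ∈ Ω := by
    have := hyW ((1 / 2 : ℝ) ^ N + (1 / 2 : ℝ) ^ N) ⟨by positivity, by linarith⟩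
    rwa [add_smul, map_add, ← add_assoc] at this
  by_contra hcon
  have hcon' : ∀ i, ‖G i (y + e + e) - 2 * G i (y + e) + G i y‖ < ((k : ℝ) + 1)⁻¹ := by
    intro i
    by_contra hi
    exact hcon (Set.mem_biUnion (Finset.mem_coe.mpr (Finset.mem_univ i)) (not_lt.mp hi))
  have hone : (1 : ℝ) ≤ ‖((f (y + e + e) - 2 * f (y + e) + f y : ℤ) : ℂ)‖ := by
    rw [Complex.norm_intCast]
    exact_mod_cast Int.one_le_abs hne
  have heq : ((f (y + e + e) - 2 * f (y + e) + f y : ℤ) : ℂ) =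
      ∑ i, (G i (y + e + e) - 2 * G i (y + e) + G i y) := by
    push_cast
    rw [h0 m0, h1 m1, h2 m2, Finset.sum_add_distrib, Finset.sum_sub_distrib, Finset.mul_sum]
  rw [heq] at hone
  have hlt : ∑ i, ‖G i (y + e + e) - 2 * G i (y + e) + G i y‖ ≤ k * ((k : ℝ) + 1)⁻¹ := by
    refine (Finset.sum_le_sum fun i _ => (hcon' i).le).trans_eq ?_
    simp
  have : (k : ℝ) * ((k : ℝ) + 1)⁻¹ < 1 := by
    rw [← div_eq_mul_inv, div_lt_one (by positivity)]; linarith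
  linarith [norm_sum_le Finset.univ fun i => G i (y + e + e) - 2 * G i (y + e) + G i y]

end

/-! ### From translation invariance to constancy -/

/-- By Fubini some single `x` satisfies `f (x + y) = f x` for almost every `y`, and the points `x +
y` fill the group. -/
theorem exists_ae_eq_const_of_translate {X : Type*} [AddCommGroup X]
    [MeasurableSpace X] [MeasurableAdd₂ X] [MeasurableNeg X] {μ : Measure X}
    [IsProbabilityMeasure μ] [μ.IsAddLeftInvariant] {f : X → ℤ}
    (hf : Measurable f) (h : ∀ y, ∀ᵐ x ∂μ, f (x + y) = f x) : ∃ c, ∀ᵐ x ∂μ, f x = c := by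
  have hm : MeasurableSet {q : X × X | f (q.2 + q.1) = f q.2} :=
    measurableSet_eq_fun (hf.comp (measurable_snd.add measurable_fst)) (hf.comp measurable_snd)
  have h1 : ∀ᵐ y ∂μ, ∀ᵐ x ∂μ, f (x + y) = f x := .of_forall h
  rw [Measure.ae_ae_comm hm] at h1
  obtain ⟨x, hx⟩ := h1.exists
  refine ⟨f x, ?_⟩
  have := (measurePreserving_sub_right μ x).quasiMeasurePreserving.ae hx
  filter_upwards [this] with y hy
  rwa [add_sub_cancel] at hy

variable {n : ℕ}

/-- The Fubini argument localized. The radius is halved so that the difference of two points of the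
smaller ball is an admissible translation, of norm less than `r`. -/
theorem exists_ae_eq_const_on_ball {f : Rn n → ℤ} (hf : Measurable f) {x₀ : Rn n} {r : ℝ}
    (hr : 0 < r)
    (h : ∀ y ∈ Metric.ball (0 : Rn n) r, ∀ᵐ x, x ∈ Metric.ball x₀ r → f (x + y) = f x) :
    ∃ c, ∀ᵐ x, x ∈ Metric.ball x₀ (r / 2) → f x = c := by
  have hm : MeasurableSet {q : Rn n × Rn n | q.1 ∈ Metric.ball 0 r → q.2 ∈ Metric.ball x₀ r →
      f (q.2 + q.1) = f q.2} := by
    have h1 : MeasurableSet {q : Rn n × Rn n | f (q.2 + q.1) = f q.2} :=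
      measurableSet_eq_fun (hf.comp (measurable_snd.add measurable_fst)) (hf.comp measurable_snd)
    have h2 : MeasurableSet {q : Rn n × Rn n | q.1 ∈ Metric.ball 0 r} :=
      measurable_fst measurableSet_ball
    have h3 : MeasurableSet {q : Rn n × Rn n | q.2 ∈ Metric.ball x₀ r} :=
      measurable_snd measurableSet_ball
    exact h2.imp (h3.imp h1)
  have h1 : ∀ᵐ y : Rn n, ∀ᵐ x : Rn n, y ∈ Metric.ball 0 r → x ∈ Metric.ball x₀ r →
      f (x + y) = f x := .of_forall fun y => by
    by_cases hy : y ∈ Metric.ball 0 r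
    · simpa [hy] using h y hy
    · simp [hy]
  rw [Measure.ae_ae_comm hm] at h1
  obtain ⟨x, hxb, hx⟩ : ∃ x ∈ Metric.ball x₀ (r / 2), ∀ᵐ y : Rn n, y ∈ Metric.ball 0 r →
      x ∈ Metric.ball x₀ r → f (x + y) = f x := by
    by_contra hcon
    have h2 : Metric.ball x₀ (r / 2) ⊆ {x | ¬∀ᵐ y : Rn n, y ∈ Metric.ball 0 r →
      x ∈ Metric.ball x₀ r → f (x + y) = f x} := fun x hx hx' => hcon ⟨x, hx, hx'⟩
    exact (Metric.measure_ball_pos volume x₀ (half_pos hr)).ne'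
      (measure_mono_null h2 h1)
  refine ⟨f x, ?_⟩
  have := (measurePreserving_sub_right volume x).quasiMeasurePreserving.ae hx
  filter_upwards [this] with y hy hyb
  rw [Metric.mem_ball] at hxb hyb
  rw [add_sub_cancel] at hy
  refine hy ?_ (Metric.mem_ball.mpr (by linarith))
  rw [mem_ball_zero_iff, ← dist_eq_norm]
  have := dist_triangle_right y x x₀
  linarith

/-- The sets `P c` of points near which `f = c` almost everywhere are open, pairwise disjoint
because balls have positive measure, and cover `Ω`; connectedness leaves only one. -/
theorem exists_ae_eq_const_of_local {f : Rn n → ℤ} {Ω : Set (Rn n)} (hΩo : IsOpen Ω)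
    (hΩ : IsConnected Ω)
    (h : ∀ x ∈ Ω, ∃ r > 0, ∃ c, ∀ᵐ y, y ∈ Metric.ball x r → f y = c) :
    ∃ c, ∀ᵐ x ∂(volume.restrict Ω), f x = c := by
  let P : ℤ → Set (Rn n) := fun c => {x | ∃ r > 0, ∀ᵐ y, y ∈ Metric.ball x r → f y = c}
  have hPo : ∀ c, IsOpen (P c) := fun c => by
    rw [Metric.isOpen_iff]
    rintro x ⟨r, hr, hx⟩
    refine ⟨r / 2, half_pos hr, fun z hz => ⟨r / 2, half_pos hr, ?_⟩⟩
    filter_upwards [hx] with y hy hyz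
    refine hy ?_
    rw [Metric.mem_ball] at *
    linarith [dist_triangle y z x]
  have hdisj : ∀ c c' x, x ∈ P c → x ∈ P c' → c = c' := by
    rintro c c' x ⟨r, hr, hx⟩ ⟨r', hr', hx'⟩
    by_contra hne
    have h0 : volume (Metric.ball x (min r r')) = 0 := by
      refine measure_mono_null ?_ (ae_iff.mp (hx.and hx'))
      intro y hy hcon
      have h1 := hcon.1 (Metric.ball_subset_ball (min_le_left _ _) hy)
      have h2 := hcon.2 (Metric.ball_subset_ball (min_le_right _ _) hy)
      exact hne (h1.symm.trans h2)
    exact (Metric.measure_ball_pos volume x (lt_min hr hr')).ne' h0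
  obtain ⟨x₀, hx₀⟩ := hΩ.nonempty
  obtain ⟨r, hr, c, hc⟩ := h x₀ hx₀
  have hsub : Ω ⊆ P c := by
    refine hΩ.isPreconnected.subset_left_of_subset_union (hPo c)
      (isOpen_iUnion fun c' : {c' // c' ≠ c} => hPo c') ?_ ?_ ⟨x₀, hx₀, r, hr, hc⟩
    · rw [Set.disjoint_left]
      intro x hx hx'
      obtain ⟨c', hx'⟩ := Set.mem_iUnion.mp hx'
      exact c'.2 (hdisj _ _ x hx' hx)
    · intro x hx
      obtain ⟨r, hr, c', hc'⟩ := h x hx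
      by_cases hcc : c' = c
      · exact Or.inl ⟨r, hr, hcc ▸ hc'⟩
      · exact Or.inr (Set.mem_iUnion.mpr ⟨⟨c', hcc⟩, r, hr, hc'⟩)
  refine ⟨c, ?_⟩
  have h0 : volume ({x | f x ≠ c} ∩ Ω) = 0 := by
    refine measure_null_of_locally_null _ fun x hx => ?_
    obtain ⟨r, hr, hxr⟩ := hsub hx.2
    refine ⟨_, inter_mem_nhdsWithin _ (Metric.ball_mem_nhds x hr), measure_mono_null ?_ hxr⟩
    rintro y ⟨⟨hy, -⟩, hyr⟩ hcon
    exact hy (hcon hyr)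
  rw [ae_iff, Measure.restrict_apply_eq_zero' hΩo.measurableSet]
  exact h0

/-! ### Exponents and the decay of the pieces -/

/-- If `sp = 1` the quotient is the Besov sequence itself, and an `ℓ^q` sequence with `q < ∞` tends
to zero. If `sp > 1` it is a bounded sequence times a geometric one of ratio `2^{1/p - s} < 1`. -/
theorem tendsto_div_of_memℓp {s : ℝ} {p q : ℝ≥0∞} (hp : 1 ≤ p) (hp' : p ≠ ∞) (hq : 1 ≤ q)
    (h : s * p.toReal = 1 ∧ q ≠ ∞ ∨ 1 < s * p.toReal) {a : ℕ → ℝ}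
    (hmem : Memℓp (fun j : ℕ => (2 : ℝ) ^ (s * j) * a j) q) :
    Tendsto (fun j => a j / ((1 / 2 : ℝ) ^ (p.toReal⁻¹)) ^ j) atTop (𝓝 0) := by
  have hpr : 0 < p.toReal := ENNReal.toReal_pos (zero_lt_one.trans_le hp).ne' hp'
  have hx : ∀ j : ℕ, (2 : ℝ) ^ (s * j) * a j * ((2 : ℝ) ^ (p.toReal⁻¹ - s)) ^ j =
      a j / ((1 / 2 : ℝ) ^ (p.toReal⁻¹)) ^ j := fun j => by
    rw [one_div, Real.inv_rpow zero_le_two, inv_pow, div_inv_eq_mul, ← Real.rpow_natCast,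
      ← Real.rpow_natCast, ← Real.rpow_mul zero_le_two, ← Real.rpow_mul zero_le_two,
      mul_right_comm, ← Real.rpow_add zero_lt_two, mul_comm]
    congr 2
    ring
  refine Tendsto.congr hx ?_
  rcases h with ⟨h1, hq'⟩ | h1
  · have hs : p.toReal⁻¹ - s = 0 := by
      rw [sub_eq_zero, inv_eq_iff_eq_inv, eq_comm]
      exact inv_eq_of_mul_eq_one_right h1
    simp only [hs, Real.rpow_zero, one_pow, mul_one]
    have hqr : 0 < q.toReal := ENNReal.toReal_pos (zero_lt_one.trans_le hq).ne' hq'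
    have := (hmem.summable hqr).tendsto_atTop_zero.rpow_const (p := q.toReal⁻¹)
      (Or.inr (by positivity))
    rw [Real.zero_rpow (by positivity)] at this
    refine tendsto_zero_iff_norm_tendsto_zero.mpr (this.congr fun j => ?_)
    rw [← Real.rpow_mul (norm_nonneg _), mul_inv_cancel₀ hqr.ne', Real.rpow_one]
  · have hlt : (2 : ℝ) ^ (p.toReal⁻¹ - s) < 1 := by
      refine Real.rpow_lt_one_of_one_lt_of_neg one_lt_two ?_
      rw [sub_neg, inv_lt_iff_one_lt_mul₀ hpr]
      exact h1
    obtain ⟨A, hA⟩ := (hmem.of_exponent_ge le_top).bddAbove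
    refine squeeze_zero_norm (fun j => ?_) (by
      simpa using (tendsto_pow_atTop_nhds_zero_of_lt_one (by positivity) hlt).const_mul A)
    rw [norm_mul, Real.norm_of_nonneg (by positivity : (0:ℝ) ≤ (2 ^ (p.toReal⁻¹ - s)) ^ j)]
    gcongr
    exact hA ⟨j, rfl⟩

theorem half_le_half_rpow {p : ℝ≥0∞} (hp : 1 ≤ p) (hp' : p ≠ ∞) :
    1 / 2 ≤ (1 / 2 : ℝ) ^ (p.toReal⁻¹) := by
  have hpr : 1 ≤ p.toReal := by
    simpa using ENNReal.toReal_mono hp' hp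
  conv_lhs => rw [← Real.rpow_one (1 / 2 : ℝ)]
  exact Real.rpow_le_rpow_of_exponent_ge (by norm_num) (by norm_num) (inv_le_one_of_one_le₀ hpr)

theorem half_rpow_lt_one {p : ℝ≥0∞} (hp : 1 ≤ p) (hp' : p ≠ ∞) :
    (1 / 2 : ℝ) ^ (p.toReal⁻¹) < 1 := by
  have hpr : 0 < p.toReal := ENNReal.toReal_pos (zero_lt_one.trans_le hp).ne' hp'
  exact Real.rpow_lt_one (by norm_num) (by norm_num) (by positivity)

section Kernel

/-- A kernel whose Fourier transform is `1` on the ball of radius `2`. -/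
theorem exists_kernel (n : ℕ) : ∃ (χ K : 𝓢(Rn n, ℂ)) (C : ℝ), 0 ≤ C ∧ 𝓕 K = χ ∧
    (∀ ξ, ‖ξ‖ ≤ 2 → χ ξ = 1) ∧ ∀ h, ∫ y, ‖K (y + h) - K y‖ ≤ C * ‖h‖ := by
  obtain ⟨χ, hχ⟩ := exists_schwartz_eq_one n
  obtain ⟨C, hC, hKC⟩ := exists_integral_norm_translate_sub_le (𝓕⁻ χ)
  exact ⟨χ, 𝓕⁻ χ, C, hC, by simp, hχ, hKC⟩

variable {n : ℕ} {X : Type*} [AddCommGroup X] [TopologicalSpace X] [IsTopologicalAddGroup X]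
  [MeasurableSpace X] [BorelSpace X] {μ : Measure X} [μ.IsAddLeftInvariant]
  [IsLocallyFiniteMeasure μ] [μ.InnerRegularCompactLTTop]

theorem tendsto_translate_diff_diff {p : ℝ≥0∞} [Fact (1 ≤ p)] (hp : p ≠ ∞) (π : Rn n →ₜ+ X)
    (K : 𝓢(Rn n, ℂ)) {C : ℝ} (hC : 0 ≤ C) (hKC : ∀ h, ∫ y, ‖K (y + h) - K y‖ ≤ C * ‖h‖)
    {U : ℕ → Lp ℂ p μ}
    (hband : ∀ j, IsBandLimited K (translate μ p π) ((1 / 2 : ℝ) ^ j) (U j))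
    (hU : Tendsto (fun j => ‖U j‖ / ((1 / 2 : ℝ) ^ (p.toReal⁻¹)) ^ j) atTop (𝓝 0)) (h : Rn n) :
    Tendsto (fun N : ℕ => ‖diff (translate μ p π) ((1 / 2 : ℝ) ^ N • h)
      (diff (translate μ p π) ((1 / 2 : ℝ) ^ N • h) (∑' j, U j))‖ /
        ((1 / 2 : ℝ) ^ (p.toReal⁻¹)) ^ N) atTop (𝓝 0) :=
  tendsto_diff_diff_tsum (translate_add π) (continuous_translate hp π) K.integrable hC hKC
    (half_le_half_rpow Fact.out hp) (half_rpow_lt_one Fact.out hp) hband hU h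

end Kernel

/-! ### Functions orthogonal to all continuous functions -/

section IntegralZero

theorem ae_eq_zero_of_forall_integral_continuous_mul {X : Type*} [TopologicalSpace X]
    [MeasurableSpace X] [BorelSpace X] [HasOuterApproxClosed X] {μ : Measure X}
    {f : X → ℂ} (hf : Integrable f μ) (h : ∀ g : C(X, ℂ), ∫ x, g x * f x ∂μ = 0) :
    f =ᵐ[μ] 0 := by
  refine ae_eq_zero_of_forall_setIntegral_isClosed_eq_zero hf fun s hs => ?_
  have h1 : Tendsto (fun k => ∫ x, ((hs.apprSeq k x : ℝ) : ℂ) * f x ∂μ) atTop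
      (𝓝 (∫ x, s.indicator f x ∂μ)) := by
    refine tendsto_integral_of_dominated_convergence (fun x => ‖f x‖) (fun k => ?_) hf.norm
      (fun k => .of_forall fun x => ?_) (.of_forall fun x => ?_)
    · refine AEStronglyMeasurable.mul (Continuous.aestronglyMeasurable ?_) hf.1
      fun_prop
    · rw [norm_mul]
      refine mul_le_of_le_one_left (norm_nonneg _) ?_
      rw [Complex.norm_real, NNReal.norm_eq]
      exact_mod_cast HasOuterApproxClosed.apprSeq_apply_le_one hs k x
    · have h2 := tendsto_pi_nhds.mp (HasOuterApproxClosed.tendsto_apprSeq hs) x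
      have h3 : Tendsto (fun k => ((hs.apprSeq k x : ℝ) : ℂ) * f x) atTop
          (𝓝 ((((s.indicator (fun _ => (1 : NNReal)) x : NNReal) : ℝ) : ℂ) * f x)) :=
        ((Complex.continuous_ofReal.tendsto _).comp
          ((NNReal.continuous_coe.tendsto _).comp h2)).mul_const _
      convert h3 using 2
      by_cases hx : x ∈ s <;> simp [hx]
  rw [integral_indicator hs.measurableSet] at h1
  refine tendsto_nhds_unique h1 (tendsto_const_nhds.congr fun k => ?_)
  exact (h ⟨fun x => ((hs.apprSeq k x : ℝ) : ℂ), by fun_prop⟩).symm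

end IntegralZero

section BandLimited

variable {n : ℕ} {E : Type*} [NormedAddCommGroup E] [NormedSpace ℂ E]
  {K : Rn n → ℂ} {T : Rn n → E →ₗᵢ[ℂ] E} {r : ℝ}

theorem IsBandLimited.sum (hcont : ∀ u, Continuous fun y => T y u) (hK : Integrable K)
    {ι : Type*} {S : Finset ι} {u : ι → E} (hu : ∀ i ∈ S, IsBandLimited K T r (u i)) :
    IsBandLimited K T r (∑ i ∈ S, u i) := by
  unfold IsBandLimited at *
  simp only [map_sum, Finset.smul_sum]
  rw [integral_finsetSum S fun i _ => by simpa using integrable_smul_translate hK hcont r (u i) 0]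
  exact Finset.sum_congr rfl hu

theorem IsBandLimited.smul {u : E} (hu : IsBandLimited K T r u) (c : ℂ) :
    IsBandLimited K T r (c • u) := by
  unfold IsBandLimited at *
  simp only [map_smul, smul_comm _ c]
  rw [integral_smul, hu]

end BandLimited

/-! ### Harmonic analysis on the torus -/

section Torus

variable (n : ℕ)

instance : (torusMeasure n).IsAddHaarMeasure := by unfold torusMeasure; infer_instance

instance : IsProbabilityMeasure (torusMeasure n) := by unfold torusMeasure; infer_instance

instance : (torusMeasure n).Regular := by
  infer_instance

/-- The projection `ℝⁿ → 𝕋ⁿ`. -/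
def torusProj : Rn n →ₜ+ UnitAddTorus (Fin n) where
  toFun y i := (y i : UnitAddCircle)
  map_zero' := by ext i; simp
  map_add' x y := by ext i; simp
  continuous_toFun := by
    refine continuous_pi fun i => ?_
    exact (AddCircle.continuous_mk' (1 : ℝ)).comp (by fun_prop)

theorem torusProj_surjective : Function.Surjective (torusProj n) := by
  intro x
  choose y hy using fun i => QuotientAddGroup.mk_surjective (x i)
  exact ⟨WithLp.toLp 2 y, funext hy⟩

variable {n}

theorem mFourierCoeff_eq (f : UnitAddTorus (Fin n) → ℂ) (m : Fin n → ℤ) :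
    mFourierCoeff f m = ∫ x, mFourier (-m) x * f x ∂(torusMeasure n) := rfl

theorem mFourier_apply_add (m : Fin n → ℤ) (x y : UnitAddTorus (Fin n)) :
    mFourier m (x + y) = mFourier m x * mFourier m y := by
  simp only [mFourier, ContinuousMap.coe_mk, Pi.add_apply, fourier_apply, smul_add,
    AddCircle.toCircle_add, Circle.coe_mul, Finset.prod_mul_distrib]

/-- The integer frequency `m` as a vector of `ℝⁿ`. -/
def freq (m : Fin n → ℤ) : Rn n := WithLp.toLp 2 fun i => (m i : ℝ)

theorem mFourier_torusProj (m : Fin n → ℤ) (y : Rn n) :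
    mFourier m (torusProj n y) = Real.fourierChar (inner ℝ y (freq m)) := by
  rw [Real.fourierChar_apply]
  change ∏ i, fourier (m i) ((y i : ℝ) : UnitAddCircle) = _
  simp only [fourier_coe_apply]
  rw [← Complex.exp_sum]
  congr 1
  simp only [PiLp.inner_apply, freq, RCLike.inner_apply, conj_trivial]
  push_cast
  rw [Finset.mul_sum, Finset.sum_mul]
  refine Finset.sum_congr rfl fun i _ => ?_
  ring

theorem integral_mFourier (m : Fin n → ℤ) :
    ∫ x, mFourier m x ∂(torusMeasure n) = if m = 0 then 1 else 0 := by
  have h := orthonormal_iff_ite.mp (orthonormal_mFourier (d := Fin n)) 0 m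
  rw [ContinuousMap.inner_toLp] at h
  simp only [mFourier_zero] at h
  simp only [eq_comm (a := m)]
  rw [← h]
  refine integral_congr_ae (.of_forall fun x => ?_)
  simp

/-- The trigonometric monomials in `L^p(𝕋ⁿ)`. -/
noncomputable def expLp (p : ℝ≥0∞) [Fact (1 ≤ p)] (m : Fin n → ℤ) : Lp ℂ p (torusMeasure n) :=
  ContinuousMap.toLp (E := ℂ) p (torusMeasure n) ℂ (mFourier m)

theorem translate_expLp (p : ℝ≥0∞) [Fact (1 ≤ p)] (m : Fin n → ℤ) (y : Rn n) :
    translate (torusMeasure n) p (torusProj n) y (expLp p m) =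
      (Real.fourierChar (inner ℝ y (freq m)) : ℂ) • expLp p m := by
  apply Lp.ext
  have h0 := ContinuousMap.coeFn_toLp (p := p) (𝕜 := ℂ) (torusMeasure n) (mFourier m)
  have h1 := (measurePreserving_add_right (torusMeasure n)
    (torusProj n y)).quasiMeasurePreserving.ae_eq h0
  filter_upwards [coeFn_translate (torusProj n) y (expLp p m), h0, h1,
    Lp.coeFn_smul (Real.fourierChar (inner ℝ y (freq m)) : ℂ) (expLp p m)] with x h2 h0 h1 h3
  rw [h2, h3, Pi.smul_apply]
  unfold expLp
  rw [h0]
  refine h1.trans ?_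
  rw [Function.comp_apply, mFourier_apply_add, mFourier_torusProj, smul_eq_mul, mul_comm]

/-- A monomial is an eigenvector of every translation, so averaging against the kernel multiplies it
by `𝓕 K (r m) = 1`. -/
theorem isBandLimited_expLp {χ K : 𝓢(Rn n, ℂ)} (hK : 𝓕 K = χ) (hχ : ∀ ξ, ‖ξ‖ ≤ 2 → χ ξ = 1)
    (p : ℝ≥0∞) [Fact (1 ≤ p)] {m : Fin n → ℤ} {r : ℝ} (hm : ‖r • freq m‖ ≤ 2) :
    IsBandLimited K (translate (torusMeasure n) p (torusProj n)) r (expLp p m) := by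
  unfold IsBandLimited
  have h1 : ∫ y, (Real.fourierChar (-inner ℝ y (r • freq m)) : ℂ) * K y = 1 := by
    rw [← hχ _ hm, ← hK, SchwartzMap.fourier_coe, Real.fourier_eq]
    rfl
  simp only [translate_expLp, smul_smul]
  rw [integral_smul_const]
  conv_rhs => rw [← one_smul ℂ (expLp p m), ← h1]
  congr 2 with y
  rw [mul_comm, inner_neg_left, inner_smul_left, inner_smul_right]
  simp

/-- Integration against `f - g` is a continuous functional on `C(𝕋ⁿ)` that kills the monomials,
whose span is dense. -/
theorem ae_eq_of_mFourierCoeff_eq {f g : UnitAddTorus (Fin n) → ℂ}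
    (hf : Integrable f (torusMeasure n)) (hg : Integrable g (torusMeasure n))
    (h : mFourierCoeff f = mFourierCoeff g) : f =ᵐ[torusMeasure n] g := by
  have hfg := hf.sub hg
  have hint : ∀ G : C(UnitAddTorus (Fin n), ℂ), Integrable (fun x => G x * (f - g) x)
      (torusMeasure n) := fun G =>
    hfg.bdd_mul G.continuous.aestronglyMeasurable (.of_forall fun x => G.norm_coe_le_norm x)
  let Φ : C(UnitAddTorus (Fin n), ℂ) →L[ℂ] ℂ := LinearMap.mkContinuous
    { toFun := fun G => ∫ x, G x * (f - g) x ∂(torusMeasure n)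
      map_add' := fun G H => by
        rw [← integral_add (hint G) (hint H)]
        simp only [ContinuousMap.add_apply, add_mul]
      map_smul' := fun c G => by
        simp only [ContinuousMap.smul_apply, smul_eq_mul, mul_assoc, RingHom.id_apply]
        exact integral_const_mul _ _ } (∫ x, ‖(f - g) x‖ ∂(torusMeasure n)) fun G => by
        refine (norm_integral_le_integral_norm _).trans ?_
        rw [← integral_mul_const]
        refine integral_mono (hint G).norm (hfg.norm.mul_const _) fun x => ?_
        simp only [norm_mul]
        rw [mul_comm]
        gcongr
        exact G.norm_coe_le_norm x
  have hΦ : Φ = 0 := by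
    refine ContinuousLinearMap.ext_on
      (Submodule.dense_iff_topologicalClosure_eq_top.mpr span_mFourier_closure_eq_top) ?_
    rintro _ ⟨m, rfl⟩
    change ∫ x, mFourier m x * (f x - g x) ∂(torusMeasure n) = 0
    have := congrFun h (-m)
    rw [mFourierCoeff_eq, mFourierCoeff_eq, neg_neg] at this
    simp only [mul_sub]
    rw [integral_sub, this, sub_self]
    · exact hf.bdd_mul (mFourier m).continuous.aestronglyMeasurable
        (.of_forall fun x => (mFourier m).norm_coe_le_norm x)
    · exact hg.bdd_mul (mFourier m).continuous.aestronglyMeasurable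
        (.of_forall fun x => (mFourier m).norm_coe_le_norm x)
  have := ae_eq_zero_of_forall_integral_continuous_mul hfg fun G => DFunLike.congr_fun hΦ G
  filter_upwards [this] with x hx
  exact sub_eq_zero.mp hx

end Torus

/-! ### Littlewood-Paley pieces on the torus -/

section Torus

variable {n : ℕ}

theorem finite_freq_le (n : ℕ) (R : ℝ) : {m : Fin n → ℤ | ‖freq m‖ ≤ R}.Finite := by
  refine (Set.finite_Icc (fun _ => -⌈R⌉ : Fin n → ℤ) (fun _ => ⌈R⌉)).subset fun m hm => ?_
  have h : ∀ i, |m i| ≤ ⌈R⌉ := fun i => by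
    have h1 : |(m i : ℝ)| ≤ R := (PiLp.norm_apply_le (freq m) i).trans hm
    exact_mod_cast h1.trans (Int.le_ceil R)
  exact ⟨fun i => (abs_le.mp (h i)).1, fun i => (abs_le.mp (h i)).2⟩

theorem toLp_two_pi_eq (m : Fin n → ℤ) :
    (WithLp.toLp 2 fun i => 2 * Real.pi * (m i : ℝ) : Rn n) = (2 * Real.pi) • freq m := by
  ext i
  simp [freq]

/-- The frequencies met by the `j`-th Littlewood-Paley piece. -/
noncomputable def freqFinset (n j : ℕ) : Finset (Fin n → ℤ) :=
  (finite_freq_le n (2 ^ j)).toFinset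

variable {φ₀ : Rn n → ℂ}

theorem IsTorusCutoff.torusPartition_eq_zero (hφ : IsTorusCutoff φ₀) {j : ℕ} {x : Rn n}
    (hx : 3 / 2 * 2 ^ j ≤ ‖x‖) : torusPartition φ₀ j x = 0 := by
  have key : ∀ i ≤ j, φ₀ (((2 : ℝ) ^ i)⁻¹ • x) = 0 := fun i hi => by
    refine hφ.eq_zero _ ?_
    rw [norm_smul, norm_inv, norm_pow, Real.norm_two, inv_mul_eq_div, le_div_iff₀ (by positivity)]
    refine le_trans ?_ hx
    gcongr
    norm_num
  cases j with
  | zero => simpa [torusPartition] using key 0 le_rfl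
  | succ j => simp [torusPartition, key j (Nat.le_succ j), key (j + 1) le_rfl]

theorem IsTorusCutoff.torusPartition_freq_eq_zero (hφ : IsTorusCutoff φ₀) {j : ℕ} {m : Fin n → ℤ}
    (hm : m ∉ freqFinset n j) : torusPartition φ₀ j ((2 * Real.pi) • freq m) = 0 := by
  refine hφ.torusPartition_eq_zero ?_
  simp only [freqFinset, Set.Finite.mem_toFinset, Set.mem_ofPred_eq, not_le] at hm
  rw [norm_smul, Real.norm_of_nonneg (by positivity)]
  -- Since `2π > 3 / 2`, the crude frequency bound `2 ^ j` already covers the support of the `j`-th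
  -- cutoff.
  have h1 : 2 * 3 * ‖freq m‖ ≤ 2 * Real.pi * ‖freq m‖ := by
    gcongr
    exact Real.pi_gt_three.le
  linarith [norm_nonneg (freq m)]

theorem sum_torusPartition (φ₀ : Rn n → ℂ) (J : ℕ) (x : Rn n) :
    ∑ j ∈ Finset.range (J + 1), torusPartition φ₀ j x = φ₀ (((2 : ℝ) ^ J)⁻¹ • x) := by
  induction J with
  | zero => simp [torusPartition]
  | succ J ih => rw [Finset.sum_range_succ, ih]; simp [torusPartition]

theorem IsTorusCutoff.eventually_sum_eq_one (hφ : IsTorusCutoff φ₀) (x : Rn n) :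
    ∀ᶠ J in atTop, ∑ j ∈ Finset.range J, torusPartition φ₀ j x = 1 := by
  obtain ⟨J₀, hJ₀⟩ := pow_unbounded_of_one_lt ‖x‖ (one_lt_two (α := ℝ))
  filter_upwards [eventually_ge_atTop (J₀ + 1)] with J hJ
  obtain ⟨J, rfl⟩ : ∃ J', J = J' + 1 := ⟨J - 1, by omega⟩
  rw [sum_torusPartition]
  refine hφ.eq_one _ ?_
  rw [norm_smul, norm_inv, norm_pow, Real.norm_two, inv_mul_lt_one₀ (by positivity)]
  exact hJ₀.trans_le (pow_le_pow_right₀ one_le_two (by omega))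

/-- The Littlewood-Paley pieces as elements of `L^p(𝕋ⁿ)`. -/
noncomputable def pieceLp (φ₀ : Rn n → ℂ) (p : ℝ≥0∞) [Fact (1 ≤ p)] (a : (Fin n → ℤ) → ℂ) (j : ℕ) :
    Lp ℂ p (torusMeasure n) :=
  ∑ m ∈ freqFinset n j, (a m * torusPartition φ₀ j ((2 * Real.pi) • freq m)) • expLp p m

variable (p : ℝ≥0∞) [Fact (1 ≤ p)] (a : (Fin n → ℤ) → ℂ)

theorem IsTorusCutoff.coeFn_pieceLp (hφ : IsTorusCutoff φ₀) (j : ℕ) :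
    pieceLp φ₀ p a j =ᵐ[torusMeasure n] torusPiece φ₀ a j := by
  have h1 : pieceLp φ₀ p a j = ContinuousMap.toLp (E := ℂ) p (torusMeasure n) ℂ
      (∑ m ∈ freqFinset n j, (a m * torusPartition φ₀ j ((2 * Real.pi) • freq m)) • mFourier m) := by
    simp only [pieceLp, expLp, map_sum, map_smul]
  rw [h1]
  refine (ContinuousMap.coeFn_toLp _ _).trans (.of_forall fun x => ?_)
  simp only [torusPiece, toLp_two_pi_eq, ContinuousMap.sum_apply, ContinuousMap.smul_apply,
    smul_eq_mul]
  refine (finsum_eq_sum_of_support_subset _ fun m hm => ?_).symm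
  by_contra hcon
  refine hm ?_
  simp only [hφ.torusPartition_freq_eq_zero hcon, mul_zero, zero_mul]

theorem IsTorusCutoff.norm_pieceLp (hφ : IsTorusCutoff φ₀) (j : ℕ) :
    ‖pieceLp φ₀ p a j‖ = (eLpNorm (torusPiece φ₀ a j) p (torusMeasure n)).toReal := by
  rw [Lp.norm_def, eLpNorm_congr_ae (hφ.coeFn_pieceLp p a j)]

/-- The Fourier coefficient functional on `L^p(𝕋ⁿ)`. -/
theorem exists_coeffCLM (m : Fin n → ℤ) : ∃ Φ : Lp ℂ p (torusMeasure n) →L[ℂ] ℂ,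
    ∀ u, Φ u = mFourierCoeff u m := by
  -- The conjugate exponent in closed form, equal to `∞` when `p = 1`.
  have hpq : ENNReal.HolderConjugate p (1 - p⁻¹)⁻¹ :=
    ENNReal.HolderConjugate.inv_one_sub_inv' Fact.out
  have : Fact (1 ≤ (1 - p⁻¹)⁻¹) := by simp [fact_iff]
  refine ⟨((ContinuousLinearMap.mul ℂ ℂ).lpPairing (torusMeasure n) (1 - p⁻¹)⁻¹ p)
    (expLp (1 - p⁻¹)⁻¹ (-m)), fun u => ?_⟩
  rw [ContinuousLinearMap.lpPairing_eq_integral, mFourierCoeff_eq]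
  refine integral_congr_ae ?_
  filter_upwards [ContinuousMap.coeFn_toLp (p := (1 - p⁻¹)⁻¹) (𝕜 := ℂ) (torusMeasure n)
    (mFourier (-m))] with x hx
  rw [expLp, hx]
  rfl

theorem mFourierCoeff_expLp (m k : Fin n → ℤ) :
    mFourierCoeff (expLp p k) m = if k = m then 1 else 0 := by
  have h : mFourierCoeff (expLp p k) m = ∫ x, mFourier (k - m) x ∂(torusMeasure n) := by
    rw [mFourierCoeff_eq]
    refine integral_congr_ae ?_
    filter_upwards [ContinuousMap.coeFn_toLp (p := p) (𝕜 := ℂ) (torusMeasure n)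
      (mFourier k)] with x hx
    rw [expLp, hx, ← mFourier_add, neg_add_eq_sub]
  rw [h, integral_mFourier]
  simp only [sub_eq_zero]

/-- A Fourier coefficient is continuous on `L^p`, and for fixed `m` the partial sums of the cutoffs
at `2πm` are eventually `1` by telescoping. -/
theorem IsTorusCutoff.mFourierCoeff_tsum_pieceLp (hφ : IsTorusCutoff φ₀) (hs : Summable (pieceLp φ₀ p a)) :
    mFourierCoeff (∑' j, pieceLp φ₀ p a j : Lp ℂ p (torusMeasure n)) = a := by
  ext m
  obtain ⟨Φ, hΦ⟩ := exists_coeffCLM p m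
  have hpiece : ∀ j, Φ (pieceLp φ₀ p a j) =
      a m * torusPartition φ₀ j ((2 * Real.pi) • freq m) := fun j => by
    simp only [pieceLp, map_sum, map_smul]
    simp only [hΦ, mFourierCoeff_expLp, smul_eq_mul, mul_ite, mul_one, mul_zero]
    rw [Finset.sum_ite_eq']
    split_ifs with hm
    · rfl
    · rw [hφ.torusPartition_freq_eq_zero hm, mul_zero]
  rw [← hΦ]
  have h1 := ((Φ.continuous.tendsto _).comp hs.hasSum.tendsto_sum_nat)
  refine tendsto_nhds_unique h1 (tendsto_const_nhds.congr' ?_)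
  filter_upwards [hφ.eventually_sum_eq_one ((2 * Real.pi) • freq m)] with J hJ
  simp only [Function.comp_apply, map_sum, hpiece]
  rw [← Finset.mul_sum, hJ, mul_one]

theorem isBandLimited_pieceLp (hp : p ≠ ∞) {χ K : 𝓢(Rn n, ℂ)} (hK : 𝓕 K = χ)
    (hχ : ∀ ξ, ‖ξ‖ ≤ 2 → χ ξ = 1) (j : ℕ) :
    IsBandLimited K (translate (torusMeasure n) p (torusProj n)) ((1 / 2 : ℝ) ^ j)
      (pieceLp φ₀ p a j) := by
  refine IsBandLimited.sum (continuous_translate hp _) K.integrable fun m hm =>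
    (isBandLimited_expLp hK hχ p ?_).smul _
  have hm : ‖freq m‖ ≤ 2 ^ j := by simpa [freqFinset] using hm
  rw [norm_smul, norm_pow, Real.norm_of_nonneg (by norm_num), one_div, inv_pow,
    inv_mul_eq_div, div_le_iff₀ (by positivity)]
  linarith [norm_nonneg (freq m)]

end Torus

theorem torus_ae_eq_const {n : ℕ} {φ₀ : Rn n → ℂ} (hφ : IsTorusCutoff φ₀)
    {f : UnitAddTorus (Fin n) → ℤ} (hf : Integrable (fun x => (f x : ℂ)) (torusMeasure n))
    {k : ℕ} {s : Fin k → ℝ} {p q : Fin k → ℝ≥0∞}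
    (hspq : ∀ j, 1 ≤ p j ∧ p j ≠ ∞ ∧ 1 ≤ q j ∧
      (s j * (p j).toReal = 1 ∧ q j ≠ ∞ ∨ 1 < s j * (p j).toReal))
    {a : Fin k → (Fin n → ℤ) → ℂ} (ha : ∀ j, a j ∈ besovTorus φ₀ (s j) (p j) (q j))
    (hfa : mFourierCoeff (fun x => (f x : ℂ)) = ∑ j, a j) :
    ∃ c : ℤ, ∀ᵐ x ∂(torusMeasure n), f x = c := by
  have hfact : ∀ i, Fact (1 ≤ p i) := fun i => ⟨(hspq i).1⟩
  obtain ⟨χ, K, C, hC, hK, hχ, hKC⟩ := exists_kernel n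
  have hU : ∀ i, Tendsto (fun j => ‖pieceLp φ₀ (p i) (a i) j‖ /
      ((1 / 2 : ℝ) ^ ((p i).toReal⁻¹)) ^ j) atTop (𝓝 0) := fun i => by
    obtain ⟨h1, h2, h3, h4⟩ := hspq i
    refine tendsto_div_of_memℓp h1 h2 h3 h4 ?_
    simpa only [hφ.norm_pieceLp (p i)] using (ha i).2
  have hs : ∀ i, Summable (pieceLp φ₀ (p i) (a i)) := fun i =>
    summable_of_tendsto_div (by positivity) (half_rpow_lt_one (hspq i).1 (hspq i).2.1) (hU i)
  let G : ∀ i, Lp ℂ (p i) (torusMeasure n) := fun i => ∑' j, pieceLp φ₀ (p i) (a i) j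
  have hGint : ∀ i, Integrable (G i) (torusMeasure n) := fun i =>
    (Lp.memLp (G i)).integrable (hspq i).1
  have hfG : (fun x => (f x : ℂ)) =ᵐ[torusMeasure n] fun x => ∑ i, G i x := by
    refine ae_eq_of_mFourierCoeff_eq hf (integrable_finsetSum _ fun i _ => hGint i) ?_
    rw [hfa]
    ext m
    have : ∀ i, Integrable (fun x => mFourier (-m) x * G i x) (torusMeasure n) := fun i =>
      (hGint i).bdd_mul (mFourier (-m)).continuous.aestronglyMeasurable
        (.of_forall fun x => (mFourier (-m)).norm_coe_le_norm x)
    rw [mFourierCoeff_eq]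
    simp only [Finset.mul_sum]
    rw [integral_finsetSum _ fun i _ => this i, Finset.sum_apply]
    refine Finset.sum_congr rfl fun i _ => ?_
    rw [← mFourierCoeff_eq, hφ.mFourierCoeff_tsum_pieceLp (p i) (a i) (hs i)]
  -- Integrability makes `f` only almost everywhere measurable; rounding a measurable representative
  -- restores integer values.
  obtain ⟨g, hg, hfg⟩ : ∃ g : UnitAddTorus (Fin n) → ℤ, Measurable g ∧ f =ᵐ[torusMeasure n] g := by
    refine ⟨fun x => round (hf.1.mk _ x).re, ?_, ?_⟩
    · simp only [round_eq]
      exact Int.measurable_floor.comp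
        ((Complex.measurable_re.comp hf.1.stronglyMeasurable_mk.measurable).add_const _)
    · filter_upwards [hf.1.ae_eq_mk] with x hx
      rw [← hx, Complex.intCast_re, round_intCast]
  have hgt : ∀ y, ∀ᵐ x ∂(torusMeasure n), g (x + y) = g x := fun y => by
    obtain ⟨h, rfl⟩ := torusProj_surjective n y
    have := ae_eq_translate_of_sum hg (π := torusProj n) (h := h) (Ω := Set.univ)
      (W := Set.univ) MeasurableSet.univ (measure_ne_top _ _) (fun _ _ _ _ => Set.mem_univ _)
      (fun i => (hspq i).2.1) G (by
        filter_upwards [hfg, hfG] with x h1 h2 _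
        rw [← h1, h2])
      (fun i => tendsto_translate_diff_diff (hspq i).2.1 (torusProj n) K hC hKC
        (isBandLimited_pieceLp (p i) (a i) (hspq i).2.1 hK hχ) (hU i) h)
    simpa using this
  obtain ⟨c, hc⟩ := exists_ae_eq_const_of_translate hg hgt
  exact ⟨c, (hfg.trans hc)⟩

/-! ### Convergence of the Littlewood-Paley decomposition on `ℝⁿ` -/

section Decomposition

variable {n : ℕ} {φ : ℕ → 𝓢(Rn n, ℂ)}

theorem IsDyadicPartition.eq_zero_of_lt (hφ : IsDyadicPartition φ) {i J : ℕ} (hi : J < i) {x : Rn n}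
    (hx : ‖x‖ < 2 ^ J) : φ i x = 0 := by
  obtain ⟨j, rfl⟩ : ∃ j, i = j + 1 := ⟨i - 1, by omega⟩
  by_contra hne
  have := (hφ.tsupport_succ j (subset_tsupport _ hne)).2
  rw [mem_ball_zero_iff, not_lt] at this
  exact absurd hx (not_lt.mpr ((pow_le_pow_right₀ one_le_two (by omega)).trans this))

theorem IsDyadicPartition.sum_eq_one_of_lt (hφ : IsDyadicPartition φ) {J : ℕ} {x : Rn n}
    (hx : ‖x‖ < 2 ^ J) : ∑ j ∈ Finset.range (J + 1), φ j x = 1 := by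
  refine (hasSum_sum_of_ne_finset_zero fun i hi => ?_).unique (hφ.sum_eq_one x)
  exact hφ.eq_zero_of_lt (by simpa using hi) hx

theorem IsDyadicPartition.norm_lt_of_ne_zero (hφ : IsDyadicPartition φ) {j : ℕ} {x : Rn n} (hx : φ j x ≠ 0) :
    ‖x‖ < 2 ^ (j + 1) := by
  rw [← mem_ball_zero_iff]
  cases j with
  | zero => simpa using hφ.tsupport_zero (subset_tsupport _ hx)
  | succ j => exact (hφ.tsupport_succ j (subset_tsupport _ hx)).1

/-- The weighted derivatives of `φ_j η` are bounded uniformly in `j`. -/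
theorem IsDyadicPartition.exists_bound (hφ : IsDyadicPartition φ) (η : 𝓢(Rn n, ℂ)) (k l : ℕ) :
    ∃ B : ℝ, 0 ≤ B ∧ ∀ (j : ℕ) (x : Rn n),
      ‖x‖ ^ k * ‖iteratedFDeriv ℝ l (fun y => φ j y * η y) x‖ ≤ B := by
  choose c hc0 hc using hφ.deriv_bound
  refine ⟨∑ i ∈ Finset.range (l + 1), (l.choose i : ℝ) * c i * SchwartzMap.seminorm ℝ k (l - i) η,
    Finset.sum_nonneg fun i _ => by have := hc0 i; positivity, fun j x => ?_⟩
  have h1 := norm_iteratedFDeriv_mul_le (𝕜 := ℝ) ((φ j).smooth ⊤) (η.smooth ⊤) x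
    (n := l) (by exact_mod_cast le_top)
  refine (mul_le_mul_of_nonneg_left h1 (by positivity)).trans ?_
  rw [Finset.mul_sum]
  refine Finset.sum_le_sum fun i _ => ?_
  have h2 : ‖iteratedFDeriv ℝ i (φ j) x‖ ≤ c i := (hc i j x).trans
    (mul_le_of_le_one_right (hc0 i).le (inv_le_one_of_one_le₀ (one_le_pow₀ one_le_two)))
  calc ‖x‖ ^ k * (l.choose i * ‖iteratedFDeriv ℝ i (φ j) x‖ * ‖iteratedFDeriv ℝ (l - i) η x‖)
      = l.choose i * ‖iteratedFDeriv ℝ i (φ j) x‖ *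
        (‖x‖ ^ k * ‖iteratedFDeriv ℝ (l - i) η x‖) := by ring
    _ ≤ _ := by
      have := (hc0 i).le
      gcongr
      exact SchwartzMap.le_seminorm ℝ k (l - i) η x

/-- Near a point with `‖x‖ < 2^J` the partial sum equals `1` and the error vanishes. For `‖x‖ ≥
2^J`, one extra power of `‖x‖` gains `2^{-J}`, which beats the `J + 1` uniformly bounded terms. -/
theorem IsDyadicPartition.tendsto_sum_smulLeft (hφ : IsDyadicPartition φ) (η : 𝓢(Rn n, ℂ)) :
    Tendsto (fun J : ℕ => ∑ j ∈ Finset.range (J + 1), SchwartzMap.smulLeftCLM ℂ (φ j) η)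
      atTop (𝓝 η) := by
  rw [(schwartz_withSeminorms ℝ (Rn n) ℂ).tendsto_nhds]
  rintro ⟨k, l⟩ ε hε
  obtain ⟨B, hB0, hB⟩ := hφ.exists_bound η (k + 1) l
  set S := SchwartzMap.seminorm ℝ (k + 1) l η
  have hS : 0 ≤ S := apply_nonneg _ _
  have hlim : Tendsto (fun J : ℕ => (((J : ℝ) + 1) * B + S) * (1 / 2 : ℝ) ^ J) atTop (𝓝 0) := by
    have h1 := tendsto_pow_const_mul_const_pow_of_abs_lt_one 1
      (by rw [abs_of_pos] <;> norm_num : |(1 / 2 : ℝ)| < 1)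
    have h2 := tendsto_pow_atTop_nhds_zero_of_lt_one (by norm_num : (0 : ℝ) ≤ 1 / 2) (by norm_num)
    have h3 := (h1.const_mul B).add (h2.const_mul (B + S))
    simp only [mul_zero, add_zero] at h3
    refine h3.congr fun J => ?_
    ring
  filter_upwards [hlim.eventually_lt_const hε] with J hJ
  refine lt_of_le_of_lt ?_ hJ
  change SchwartzMap.seminorm ℝ k l _ ≤ _
  have hcoe : ∀ j x, SchwartzMap.smulLeftCLM ℂ (φ j) η x = φ j x * η x := fun j x => by
    rw [SchwartzMap.smulLeftCLM_apply_apply (φ j).hasTemperateGrowth, smul_eq_mul]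
  have hfun : ∀ j, (SchwartzMap.smulLeftCLM ℂ (φ j) η : Rn n → ℂ) = fun x => φ j x * η x :=
    fun j => funext (hcoe j)
  refine SchwartzMap.seminorm_le_bound ℝ k l _ (by positivity) fun x => ?_
  rcases lt_or_ge ‖x‖ (2 ^ J) with hx | hx
  · have h0 : (∑ j ∈ Finset.range (J + 1), SchwartzMap.smulLeftCLM ℂ (φ j) η - η : 𝓢(Rn n, ℂ))
        =ᶠ[𝓝 x] fun _ => (0 : ℂ) := by
      filter_upwards [(continuous_norm.isOpen_preimage _ isOpen_Iio).mem_nhds hx] with y hy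
      rw [sub_apply, sum_apply]
      simp only [hcoe]
      rw [← Finset.sum_mul, hφ.sum_eq_one_of_lt hy, one_mul, sub_self]
    rw [(Filter.EventuallyEq.iteratedFDeriv ℝ h0 l).eq_of_nhds, iteratedFDeriv_fun_zero]
    simp only [Pi.zero_apply, norm_zero, mul_zero]
    positivity
  · have hx0 : 0 < ‖x‖ := lt_of_lt_of_le (by positivity) hx
    have h1 : ‖x‖ ^ (k + 1) * ‖iteratedFDeriv ℝ l
        (∑ j ∈ Finset.range (J + 1), SchwartzMap.smulLeftCLM ℂ (φ j) η - η : 𝓢(Rn n, ℂ)) x‖ ≤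
        ((J : ℝ) + 1) * B + S := by
      have h2 : iteratedFDeriv ℝ l
          (∑ j ∈ Finset.range (J + 1), SchwartzMap.smulLeftCLM ℂ (φ j) η - η : 𝓢(Rn n, ℂ)) x =
          ∑ j ∈ Finset.range (J + 1), iteratedFDeriv ℝ l (fun y => φ j y * η y) x -
            iteratedFDeriv ℝ l η x := by
        have e : ((∑ j ∈ Finset.range (J + 1), SchwartzMap.smulLeftCLM ℂ (φ j) η - η :
            𝓢(Rn n, ℂ)) : Rn n → ℂ) =
            (fun y => ∑ j ∈ Finset.range (J + 1), φ j y * η y) - η := by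
          ext y
          rw [sub_apply, sum_apply]
          simp only [hcoe, Pi.sub_apply]
        have hsm : ∀ j, ContDiffAt ℝ l (fun y => φ j y * η y) x := fun j =>
          (((φ j).smooth l).mul (η.smooth l)).contDiffAt
        rw [e, iteratedFDeriv_sub_apply (ContDiffAt.sum fun j _ => hsm j)
          (η.smooth l).contDiffAt, iteratedFDeriv_fun_sum_apply fun j _ => hsm j]
      rw [h2]
      refine (mul_le_mul_of_nonneg_left ((norm_sub_le _ _).trans
        (add_le_add_left (norm_sum_le _ _) _)) (by positivity)).trans ?_
      rw [mul_add, Finset.mul_sum]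
      refine add_le_add ((Finset.sum_le_sum fun j _ => hB j x).trans_eq (by simp)) ?_
      exact SchwartzMap.le_seminorm ℝ (k + 1) l η x
    rw [one_div, inv_pow, ← div_eq_mul_inv, le_div_iff₀ (by positivity)]
    refine le_trans ?_ h1
    rw [pow_succ, mul_right_comm]
    gcongr

theorem exists_pairingCLM (p : ℝ≥0∞) [Fact (1 ≤ p)] (ψ : 𝓢(Rn n, ℂ)) :
    ∃ Φ : Lp ℂ p (volume : Measure (Rn n)) →L[ℂ] ℂ, ∀ u, Φ u = ∫ x, ψ x * u x := by
  have hpq : ENNReal.HolderConjugate p (1 - p⁻¹)⁻¹ :=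
    ENNReal.HolderConjugate.inv_one_sub_inv' Fact.out
  have : Fact (1 ≤ (1 - p⁻¹)⁻¹) := by simp [fact_iff]
  refine ⟨((ContinuousLinearMap.mul ℂ ℂ).lpPairing volume (1 - p⁻¹)⁻¹ p)
    (ψ.toLp (1 - p⁻¹)⁻¹), fun u => ?_⟩
  rw [ContinuousLinearMap.lpPairing_eq_integral]
  refine integral_congr_ae ?_
  filter_upwards [ψ.coeFn_toLp (1 - p⁻¹)⁻¹ volume] with x hx
  rw [hx]
  rfl

/-- The Littlewood-Paley decomposition converges to `g`. -/
theorem IsDyadicPartition.eq_tsum (hφ : IsDyadicPartition φ) {p : ℝ≥0∞} [Fact (1 ≤ p)]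
    {g : 𝓢'(Rn n, ℂ)} {u : ℕ → Lp ℂ p (volume : Measure (Rn n))}
    (hu : ∀ j, TemperedDistribution.fourierMultiplierCLM ℂ (φ j) g = (u j : 𝓢'(Rn n, ℂ)))
    (hs : Summable u) (ψ : 𝓢(Rn n, ℂ)) : g ψ = ∫ x, ψ x * (∑' j, u j : Lp ℂ p volume) x := by
  have h1 : Tendsto (fun J : ℕ => ∑ j ∈ Finset.range (J + 1), (u j : 𝓢'(Rn n, ℂ)) ψ) atTop
      (𝓝 (g ψ)) := by
    -- By duality the multipliers act on the test function: it suffices that the cutoffs of `𝓕⁻ ψ`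
    -- converge in the Schwartz space.
    have h2 := ((hφ.tendsto_sum_smulLeft (𝓕⁻ ψ)))
    have h3 : Continuous fun η : 𝓢(Rn n, ℂ) => g (𝓕 η) :=
      g.continuous.comp (fourierCLM ℂ 𝓢(Rn n, ℂ)).continuous
    have h4 := (h3.tendsto _).comp h2
    rw [fourier_fourierInv_eq] at h4
    refine h4.congr fun J => ?_
    rw [Function.comp_apply, ← fourierCLM_apply (R := ℂ), map_sum, map_sum]
    refine Finset.sum_congr rfl fun j _ => ?_
    rw [← hu j]
    rfl
  obtain ⟨Φ, hΦ⟩ := exists_pairingCLM p ψ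
  have h5 : Tendsto (fun J : ℕ => ∑ j ∈ Finset.range (J + 1), (u j : 𝓢'(Rn n, ℂ)) ψ) atTop
      (𝓝 (Φ (∑' j, u j))) := by
    refine (((Φ.continuous.tendsto _).comp hs.hasSum.tendsto_sum_nat).comp
      (tendsto_add_atTop_nat 1)).congr fun J => ?_
    rw [Function.comp_apply, Function.comp_apply, map_sum]
    simp only [hΦ, Lp.toTemperedDistribution_apply, smul_eq_mul]
  rw [tendsto_nhds_unique h1 h5, hΦ]

end Decomposition

/-! ### Band-limitation of the pieces on `ℝⁿ` -/

section Band

variable {n : ℕ}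

/-- The multiplication formula `∫ K̂ g = ∫ K ĝ` for the pairing `r⟨·,·⟩`, with `g` the modulation of
`𝓕⁻ ψ` by `x`; its transform at `y` is `ψ (x + r y)`. Using the scaled pairing avoids a change of
variables. -/
theorem fourier_smulLeft_eq_integral {χ K : 𝓢(Rn n, ℂ)} (hK : 𝓕 K = χ) (r : ℝ)
    (ψ : 𝓢(Rn n, ℂ)) (x : Rn n) :
    𝓕 (SchwartzMap.smulLeftCLM ℂ (fun ξ => χ (r • ξ)) (𝓕⁻ ψ)) x = ∫ y, K y * ψ (x + r • y) := by
  have hL : Continuous fun q : Rn n × Rn n => (r • innerₗ (Rn n)) q.1 q.2 := by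
    simp only [LinearMap.smul_apply, innerₗ_apply_apply]
    fun_prop
  have hχ : (fun ξ => χ (r • ξ)).HasTemperateGrowth := by
    have := χ.hasTemperateGrowth
    fun_prop
  set η := 𝓕⁻ ψ with hη
  have hψ : ψ = 𝓕 η := by rw [hη, fourier_fourierInv_eq]
  let g : Rn n → ℂ := fun ξ => ((Real.fourierChar (-inner ℝ ξ x) : Circle) : ℂ) * η ξ
  have hg : Integrable g := by
    refine η.integrable.bdd_mul (c := 1) (Continuous.aestronglyMeasurable ?_)
      (.of_forall fun ξ => (Circle.norm_coe _).le)
    have := Real.continuous_fourierChar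
    fun_prop
  have key := VectorFourier.integral_fourierIntegral_smul_eq_flip (μ := volume) (ν := volume)
    (L := r • innerₗ (Rn n)) Real.continuous_fourierChar hL K.integrable hg
  rw [SchwartzMap.fourier_coe, Real.fourier_eq]
  trans ∫ ξ, VectorFourier.fourierIntegral Real.fourierChar volume (r • innerₗ (Rn n)) K ξ • g ξ
  · congr 1 with ξ
    have h1 : VectorFourier.fourierIntegral Real.fourierChar volume (r • innerₗ (Rn n)) K ξ =
        χ (r • ξ) := by
      rw [← hK, SchwartzMap.fourier_coe, Real.fourier_eq]
      simp only [VectorFourier.fourierIntegral, LinearMap.smul_apply, innerₗ_apply_apply,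
        inner_smul_right, smul_eq_mul]
    rw [h1, SchwartzMap.smulLeftCLM_apply_apply hχ]
    simp only [g, Circle.smul_def, smul_eq_mul]
    ring
  · rw [key]
    congr 1 with y
    rw [hψ, SchwartzMap.fourier_coe, Real.fourier_eq, smul_eq_mul]
    congr 1
    simp only [VectorFourier.fourierIntegral, g]
    congr 1 with ξ
    simp only [Circle.smul_def, smul_eq_mul, LinearMap.flip_apply, LinearMap.smul_apply,
      innerₗ_apply_apply]
    rw [← mul_assoc, inner_add_right, neg_add, AddChar.map_add_eq_mul, Circle.coe_mul,
      inner_smul_right, real_inner_comm ξ y, mul_comm ((Real.fourierChar _ : Circle) : ℂ)]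

/-- Hölder in the second variable gives a bound uniform in the translation, and `K` is integrable;
this licenses Fubini. -/
theorem integrable_kernel_mul {K ψ : 𝓢(Rn n, ℂ)} (r : ℝ) {p : ℝ≥0∞} [Fact (1 ≤ p)]
    (u : Lp ℂ p (volume : Measure (Rn n))) :
    Integrable (fun q : Rn n × Rn n => K q.1 * (ψ (q.2 + r • q.1) * u q.2))
      ((volume : Measure (Rn n)).prod volume) := by
  have hpq : ENNReal.HolderConjugate (1 - p⁻¹)⁻¹ p :=
    (ENNReal.HolderConjugate.inv_one_sub_inv' Fact.out).symm
  have hm : AEStronglyMeasurable (fun q : Rn n × Rn n => K q.1 * (ψ (q.2 + r • q.1) * u q.2))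
      ((volume : Measure (Rn n)).prod volume) := by
    refine AEStronglyMeasurable.mul (Continuous.aestronglyMeasurable (by fun_prop))
      (AEStronglyMeasurable.mul (Continuous.aestronglyMeasurable (by fun_prop)) ?_)
    exact (Lp.stronglyMeasurable u).aestronglyMeasurable.comp_snd
  refine ⟨hm, ?_⟩
  rw [HasFiniteIntegral, lintegral_prod _ hm.enorm]
  have hb : ∀ y, ∫⁻ x, ‖K y * (ψ (x + r • y) * u x)‖ₑ ≤
      ‖K y‖ₑ * (eLpNorm ψ (1 - p⁻¹)⁻¹ volume * eLpNorm u p volume) := fun y => by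
    simp only [enorm_mul (K y)]
    rw [lintegral_const_mul' _ _ enorm_ne_top, ← eLpNorm_one_eq_lintegral_enorm]
    gcongr
    have hmp := measurePreserving_add_right (volume : Measure (Rn n)) (r • y)
    rw [← eLpNorm_comp_measurePreserving ψ.continuous.aestronglyMeasurable hmp]
    have hψ : AEStronglyMeasurable (ψ ∘ fun x => x + r • y) volume :=
      Continuous.aestronglyMeasurable (by fun_prop)
    exact eLpNorm_smul_le_mul_eLpNorm (p := (1 - p⁻¹)⁻¹) (q := p) (r := 1)
      (f := u) (φ := ψ ∘ fun x => x + r • y) (Lp.stronglyMeasurable u).aestronglyMeasurable hψ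
  refine (lintegral_mono hb).trans_lt ?_
  rw [lintegral_mul_const _ (by fun_prop)]
  exact ENNReal.mul_lt_top K.integrable.2
    (ENNReal.mul_lt_top (ψ.memLp _ _).2 (Lp.memLp u).2)

/-- An `L^p` function whose spectrum lies where `χ (r ξ) = 1` is reproduced by the rescaled
kernel. -/
theorem isBandLimited_of_fourierMultiplier {χ K : 𝓢(Rn n, ℂ)} (hK : 𝓕 K = χ) {r : ℝ}
    {p : ℝ≥0∞} [Fact (1 ≤ p)] (hp : p ≠ ∞) {u : Lp ℂ p (volume : Measure (Rn n))}
    (hu : TemperedDistribution.fourierMultiplierCLM ℂ (fun ξ => χ (r • ξ)) (u : 𝓢'(Rn n, ℂ)) =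
      (u : 𝓢'(Rn n, ℂ))) :
    IsBandLimited K (translate volume p (ContinuousAddMonoidHom.id (Rn n))) r u := by
  set π := ContinuousAddMonoidHom.id (Rn n)
  have hint := integrable_smul_translate (K := K) K.integrable (continuous_translate hp π) r u 0
  simp only [zero_sub] at hint
  -- `L^p` embeds into the tempered distributions, so the identity may be tested against Schwartz
  -- functions.
  have hinj := LinearMap.ker_eq_bot.mp (Lp.ker_toTemperedDistributionCLM_eq_bot (F := ℂ)
    (μ := (volume : Measure (Rn n))) (p := p))
  refine hinj ?_
  change ((∫ y, K y • translate volume p π (-(r • y)) u : Lp ℂ p volume) : 𝓢'(Rn n, ℂ)) = u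
  ext ψ
  obtain ⟨Φ, hΦ⟩ := exists_pairingCLM p ψ
  have h1 : ∀ v : Lp ℂ p (volume : Measure (Rn n)), (v : 𝓢'(Rn n, ℂ)) ψ = Φ v := fun v => by
    rw [hΦ, Lp.toTemperedDistribution_apply]
    rfl
  have h2 : ∀ y, Φ (translate volume p π (-(r • y)) u) = ∫ x, ψ (x + r • y) * u x := fun y => by
    rw [hΦ, ← integral_add_right_eq_self _ (r • y)]
    refine integral_congr_ae ?_
    filter_upwards [(measurePreserving_add_right volume (r • y)).quasiMeasurePreserving.ae
      (coeFn_translate π (-(r • y)) u)] with x hx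
    rw [hx]
    change _ * u (x + r • y + -(r • y)) = _
    rw [add_neg_cancel_right]
  calc _ = Φ (∫ y, K y • translate volume p π (-(r • y)) u) := h1 _
    _ = ∫ y, ∫ x, K y * (ψ (x + r • y) * u x) := by
      rw [← Φ.integral_comp_comm hint]
      congr 1 with y
      rw [map_smul, h2, smul_eq_mul, ← integral_const_mul]
    _ = ∫ x, ∫ y, K y * (ψ (x + r • y) * u x) := integral_integral_swap (integrable_kernel_mul r u)
    _ = ∫ x, 𝓕 (SchwartzMap.smulLeftCLM ℂ (fun ξ => χ (r • ξ)) (𝓕⁻ ψ)) x * u x := by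
      congr 1 with x
      rw [fourier_smulLeft_eq_integral hK, ← integral_mul_const]
      simp only [mul_assoc]
    _ = TemperedDistribution.fourierMultiplierCLM ℂ (fun ξ => χ (r • ξ)) (u : 𝓢'(Rn n, ℂ)) ψ := by
      rw [TemperedDistribution.fourierMultiplierCLM_apply_apply, Lp.toTemperedDistribution_apply]
      rfl
    _ = _ := by rw [hu]

theorem IsDyadicPartition.isBandLimited {φ : ℕ → 𝓢(Rn n, ℂ)} (hφ : IsDyadicPartition φ)
    {χ K : 𝓢(Rn n, ℂ)} (hK : 𝓕 K = χ) (hχ : ∀ ξ, ‖ξ‖ ≤ 2 → χ ξ = 1)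
    {p : ℝ≥0∞} [Fact (1 ≤ p)] (hp : p ≠ ∞) {g : 𝓢'(Rn n, ℂ)}
    {u : ℕ → Lp ℂ p (volume : Measure (Rn n))}
    (hu : ∀ j, TemperedDistribution.fourierMultiplierCLM ℂ (φ j) g = (u j : 𝓢'(Rn n, ℂ))) (j : ℕ) :
    IsBandLimited K (translate volume p (ContinuousAddMonoidHom.id (Rn n))) ((1 / 2 : ℝ) ^ j)
      (u j) := by
  refine isBandLimited_of_fourierMultiplier hK hp ?_
  have hχg : (fun ξ => χ ((1 / 2 : ℝ) ^ j • ξ)).HasTemperateGrowth := by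
    have := χ.hasTemperateGrowth
    fun_prop
  rw [← hu j, TemperedDistribution.fourierMultiplierCLM_fourierMultiplierCLM_apply
    (φ j).hasTemperateGrowth hχg]
  -- The support of `φ j` lies in `‖ξ‖ < 2^{j+1}`, where `χ (2^{-j} ξ) = 1`; this is why `χ` is `1`
  -- up to radius `2`.
  suffices h : (φ j : Rn n → ℂ) * (fun ξ => χ ((1 / 2 : ℝ) ^ j • ξ)) = φ j by rw [h]
  ext ξ
  rw [Pi.mul_apply]
  by_cases h0 : φ j ξ = 0
  · rw [h0, zero_mul]
  · rw [hχ, mul_one]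
    have := hφ.norm_lt_of_ne_zero h0
    rw [norm_smul, norm_pow, Real.norm_of_nonneg (by norm_num), one_div, inv_pow,
      inv_mul_eq_div, div_le_iff₀ (by positivity), ← pow_succ']
    exact this.le

end Band

/-! ### Conclusion on domains, and the theorem -/

theorem ae_eq_sum_of_ofFunction_eq {n : ℕ} {Ω : Opens (Rn n)} {f : Rn n → ℂ}
    (hf : LocallyIntegrableOn f (Ω : Set (Rn n))) {k : ℕ} {p : Fin k → ℝ≥0∞}
    [∀ j, Fact (1 ≤ p j)] (G : ∀ i, Lp ℂ (p i) (volume : Measure (Rn n)))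
    (h : ∀ ψ : 𝓓(Ω, ℝ), ofFunction Ω f ψ = ∑ i, ∫ x, testToSchwartz ψ x * G i x) :
    ∀ᵐ x, x ∈ (Ω : Set (Rn n)) → f x = ∑ i, G i x := by
  have hG : ∀ i, LocallyIntegrable (G i) := fun i =>
    (Lp.memLp (G i)).locallyIntegrable Fact.out
  have hsum : LocallyIntegrable fun x => ∑ i, G i x :=
    locallyIntegrable_finsetSum _ fun i _ => hG i
  have key := Ω.isOpen.ae_eq_zero_of_integral_contDiff_smul_eq_zero
    (f := fun x => f x - ∑ i, G i x) (μ := volume)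
    (hf.sub (hsum.locallyIntegrableOn _)) ?_
  · filter_upwards [key] with x hx hxΩ
    exact sub_eq_zero.mp (hx hxΩ)
  intro w hw hwc hwΩ
  let ψ : 𝓓(Ω, ℝ) := ⟨w, hw, hwc, hwΩ⟩
  have h1 := h ψ
  rw [ofFunction_apply hf] at h1
  have h2 : Integrable fun x => w x • f x := by
    refine (integrableOn_iff_integrable_of_support_subset (s := tsupport w) ?_).mp
      ((hf.integrableOn_compact_subset hwΩ hwc).continuousOn_smul hw.continuous.continuousOn hwc)
    exact (Function.support_smul_subset_left w f).trans (subset_tsupport w)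
  have h3 : ∀ i, Integrable fun x => w x • G i x := fun i =>
    (hG i).integrable_smul_left_of_hasCompactSupport hw.continuous hwc
  simp only [smul_sub, Finset.smul_sum]
  rw [integral_sub h2 (integrable_finsetSum _ fun i _ => h3 i),
    integral_finsetSum _ fun i _ => h3 i, sub_eq_zero]
  simp only [Complex.real_smul]
  exact h1

theorem domain_ae_eq_const {n : ℕ} {φ : ℕ → 𝓢(Rn n, ℂ)} (hφ : IsDyadicPartition φ)
    {Ω : Opens (Rn n)} (hΩ : IsConnected (Ω : Set (Rn n))) {f : Rn n → ℤ}
    (hf : LocallyIntegrableOn (fun x => (f x : ℂ)) (Ω : Set (Rn n)))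
    {k : ℕ} {s : Fin k → ℝ} {p q : Fin k → ℝ≥0∞} [∀ j, Fact (1 ≤ p j)]
    (hspq : ∀ j, p j ≠ ∞ ∧ 1 ≤ q j ∧
      (s j * (p j).toReal = 1 ∧ q j ≠ ∞ ∨ 1 < s j * (p j).toReal))
    {T : Fin k → 𝓓'(Ω, ℂ)} (hT : ∀ j, T j ∈ besovOn φ (s j) (p j) (q j) Ω)
    (hfT : ofFunction Ω (fun x => (f x : ℂ)) = ∑ j, T j) :
    ∃ c : ℤ, ∀ᵐ x ∂(volume.restrict (Ω : Set (Rn n))), f x = c := by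
  obtain ⟨χ, K, C, hC, hK, hχ, hKC⟩ := exists_kernel n
  choose g hg hTg using hT
  choose u hu hmem using hg
  have hU : ∀ i, Tendsto (fun j => ‖u i j‖ / ((1 / 2 : ℝ) ^ ((p i).toReal⁻¹)) ^ j) atTop (𝓝 0) :=
    fun i => tendsto_div_of_memℓp Fact.out (hspq i).1 (hspq i).2.1 (hspq i).2.2 (hmem i)
  have hs : ∀ i, Summable (u i) := fun i =>
    summable_of_tendsto_div (by positivity) (half_rpow_lt_one Fact.out (hspq i).1) (hU i)
  let G : ∀ i, Lp ℂ (p i) (volume : Measure (Rn n)) := fun i => ∑' j, u i j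
  have hfG : ∀ᵐ x, x ∈ (Ω : Set (Rn n)) → (f x : ℂ) = ∑ i, G i x := by
    refine ae_eq_sum_of_ofFunction_eq hf G fun ψ => ?_
    rw [hfT, sum_apply]
    refine Finset.sum_congr rfl fun i _ => ?_
    rw [hTg, hφ.eq_tsum (hu i) (hs i)]
  -- `f` is arbitrary outside `Ω`; `w` is a measurable integer-valued function on all of `ℝⁿ` that
  -- agrees with `f` almost everywhere on `Ω`.
  let w : Rn n → ℤ := fun x => round (∑ i, G i x).re
  have hw : Measurable w := by
    simp only [w, round_eq]
    refine Int.measurable_floor.comp ((Complex.measurable_re.comp ?_).add_const _)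
    exact Finset.measurable_fun_sum _ fun i _ => (Lp.stronglyMeasurable (G i)).measurable
  have hfw : ∀ᵐ x, x ∈ (Ω : Set (Rn n)) → f x = w x := by
    filter_upwards [hfG] with x hx hxΩ
    simp only [w]
    rw [← hx hxΩ, Complex.intCast_re, round_intCast]
  have hloc : ∀ x ∈ (Ω : Set (Rn n)), ∃ r > 0, ∃ c, ∀ᵐ y, y ∈ Metric.ball x r → w y = c := by
    intro x hx
    obtain ⟨R, hR, hball⟩ := Metric.isOpen_iff.mp Ω.isOpen x hx
    -- A point of the ball moved by `t h` with `t ≤ 3` stays within `R / 4 + 3 R / 4 = R` of `x`.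
    have hr : 0 < R / 4 := by positivity
    obtain ⟨c, hc⟩ := exists_ae_eq_const_on_ball hw (x₀ := x) hr fun h hh => by
      refine ae_eq_translate_of_sum hw (π := ContinuousAddMonoidHom.id (Rn n)) (h := h)
        (Ω := (Ω : Set (Rn n))) measurableSet_ball measure_ball_lt_top.ne ?_
        (fun i => (hspq i).1) G ?_
        (fun i => tendsto_translate_diff_diff (hspq i).1 _ K hC hKC
          (hφ.isBandLimited hK hχ (hspq i).1 (hu i)) (hU i) h)
      · intro y hy t ht
        refine hball ?_
        change y + t • h ∈ _
        rw [Metric.mem_ball, dist_eq_norm] at hy ⊢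
        rw [mem_ball_zero_iff] at hh
        have h1 : ‖t • h‖ ≤ 3 * ‖h‖ := by
          rw [norm_smul, Real.norm_of_nonneg ht.1]
          gcongr
          exact ht.2
        have h2 := norm_add_le (y - x) (t • h)
        rw [sub_add_eq_add_sub] at h2
        linarith
      · filter_upwards [hfG, hfw] with y h1 h2 hy
        rw [← h1 hy, h2 hy]
    exact ⟨_, half_pos hr, c, hc⟩
  obtain ⟨c, hc⟩ := exists_ae_eq_const_of_local Ω.isOpen hΩ hloc
  refine ⟨c, ?_⟩
  filter_upwards [hc, (ae_restrict_iff' Ω.isOpen.measurableSet).mpr hfw] with x h1 h2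
  rw [h2, h1]

end Besov

theorem lemma6p22 (n : ℕ) :
    -- connected open subsets of `ℝⁿ`
    (∀ φ : ℕ → 𝓢(Besov.Rn n, ℂ), Besov.IsDyadicPartition φ →
      ∀ Ω : Opens (Besov.Rn n), IsConnected (Ω : Set (Besov.Rn n)) →
      ∀ f : Besov.Rn n → ℤ, LocallyIntegrableOn (fun x => (f x : ℂ)) (Ω : Set (Besov.Rn n)) →
        (∀ (s : ℝ) (p q : ℝ≥0∞) [Fact (1 ≤ p)], 0 < s → p ≠ ∞ → 1 ≤ q →
          (1 ≤ s * p.toReal ∧ q ≠ ∞ ∨ 1 < s * p.toReal ∧ q = ∞) →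
          Besov.ofFunction Ω (fun x => (f x : ℂ)) ∈ Besov.besovOn φ s p q Ω →
          ∃ c : ℤ, ∀ᵐ x ∂(volume.restrict (Ω : Set (Besov.Rn n))), f x = c) ∧
        (∀ (k : ℕ) (s : Fin k → ℝ) (p q : Fin k → ℝ≥0∞) [∀ j, Fact (1 ≤ p j)],
          (∀ j, 0 < s j ∧ p j ≠ ∞ ∧ 1 ≤ q j ∧
            (s j * (p j).toReal = 1 ∧ q j ≠ ∞ ∨ 1 < s j * (p j).toReal)) →
          ∀ T : Fin k → 𝓓'(Ω, ℂ), (∀ j, T j ∈ Besov.besovOn φ (s j) (p j) (q j) Ω) →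
          Besov.ofFunction Ω (fun x => (f x : ℂ)) = ∑ j, T j →
          ∃ c : ℤ, ∀ᵐ x ∂(volume.restrict (Ω : Set (Besov.Rn n))), f x = c)) ∧
    -- the torus `𝕋ⁿ`
    (∀ φ₀ : Besov.Rn n → ℂ, Besov.IsTorusCutoff φ₀ →
      ∀ f : UnitAddTorus (Fin n) → ℤ,
        Integrable (fun x => (f x : ℂ)) (Besov.torusMeasure n) →
        (∀ (s : ℝ) (p q : ℝ≥0∞), 0 < s → 1 ≤ p → p ≠ ∞ → 1 ≤ q →
          (1 ≤ s * p.toReal ∧ q ≠ ∞ ∨ 1 < s * p.toReal ∧ q = ∞) →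
          UnitAddTorus.mFourierCoeff (fun x => (f x : ℂ)) ∈ Besov.besovTorus φ₀ s p q →
          ∃ c : ℤ, ∀ᵐ x ∂(Besov.torusMeasure n), f x = c) ∧
        (∀ (k : ℕ) (s : Fin k → ℝ) (p q : Fin k → ℝ≥0∞),
          (∀ j, 0 < s j ∧ 1 ≤ p j ∧ p j ≠ ∞ ∧ 1 ≤ q j ∧
            (s j * (p j).toReal = 1 ∧ q j ≠ ∞ ∨ 1 < s j * (p j).toReal)) →
          ∀ a : Fin k → (Fin n → ℤ) → ℂ,
          (∀ j, a j ∈ Besov.besovTorus φ₀ (s j) (p j) (q j)) →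
          UnitAddTorus.mFourierCoeff (fun x => (f x : ℂ)) = ∑ j, a j →
          ∃ c : ℤ, ∀ᵐ x ∂(Besov.torusMeasure n), f x = c)) := by
  -- The first assertion is the second with one summand, once `1 ≤ sp` is split into equality and
  -- strict inequality.
  have exponents : ∀ {s : ℝ} {p q : ℝ≥0∞},
      (1 ≤ s * p.toReal ∧ q ≠ ∞ ∨ 1 < s * p.toReal ∧ q = ∞) →
      (s * p.toReal = 1 ∧ q ≠ ∞ ∨ 1 < s * p.toReal) := by
    rintro s p q (⟨h, hq⟩ | ⟨h, -⟩)
    · exact h.eq_or_lt.imp (fun h => ⟨h.symm, hq⟩) id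
    · exact Or.inr h
  refine ⟨fun φ hφ Ω hΩ f hf => ⟨?_, ?_⟩, fun φ₀ hφ f hf => ⟨?_, ?_⟩⟩
  · intro s p q _ _ hp hq h hmem
    exact Besov.domain_ae_eq_const hφ hΩ hf (k := 1) (s := fun _ => s) (p := fun _ => p)
      (q := fun _ => q) (fun _ => ⟨hp, hq, exponents h⟩) (fun _ => hmem) (by simp)
  · intro k s p q _ h T hT hfT
    exact Besov.domain_ae_eq_const hφ hΩ hf (fun j => (h j).2) hT hfT
  · intro s p q _ hp1 hp hq h hmem
    exact Besov.torus_ae_eq_const hφ hf (k := 1) (s := fun _ => s) (p := fun _ => p)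
      (q := fun _ => q) (fun _ => ⟨hp1, hp, hq, exponents h⟩) (fun _ => hmem) (by simp)
  · intro k s p q h a ha hfa
    exact Besov.torus_ae_eq_const hφ hf (fun j => (h j).2) ha hfa
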